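/- Let $X$ be a compact metrizable space with a $d$-dimensional lamination $\mathcal L$, that is, an atlas of homeomorphisms $\varphi_i=(z_i,t_i):U_i\to(-1,1)^d\times T_i$ ($U_i\subset X$ open, $\bigcup_i U_i=X$, $T_i$ metrizable) whose transition maps have the form $(z,t)\mapsto(\zeta_{ij}(z,t),\tau_{ij}(t))$, where $\tau_{ij}$ is a homeomorphism between open sets and $\zeta_{ij}(\cdot,t)$ is a smooth diffeomorphism onto its image, depending continuously on $t$ in the $C^\infty_{\mathrm{loc}}$ topology. The plaques $\varphi_i^{-1}((-1,1)^d\times\{t\})$ glue together to form the leaves. Let $g$ be a laminated metric: a smooth Riemannian metric $g_L$ on each leaf $L$, which in the laminated charts depends continuously on $t$ in the $C^\infty_{\mathrm{loc}}$ topology. Let $(M,g_M)$ be a connected smooth Riemannian manifold (without boundary, not necessarily complete). Let $\Phi_n:M\to X$, $n\in\mathbb N$, be maps such that each $\Phi_n$ sends $M$ into a leaf $L_n$ of $\mathcal L$ and is smooth as a map $M\to L_n$. For $k\ge 1$, let $D^k\Phi_n$ be the $k$-th covariant derivative of $\Phi_n:M\to L_n$ ($D^1\Phi_n=d\Phi_n$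 and $D^{k+1}\Phi_n=\nabla D^k\Phi_n$, for the connection induced by the Levi-Civita connections of $g_M$ and $g_{L_n}$), and let $\|\cdot\|$ be the pointwise norm of multilinear maps given by $g_M$ and $g_{L_n}$. Suppose that for every compact $K\subset M$ and every $k\ge1$ there is $A>0$ such that $$\|D^k\Phi_n(x)\|\le A\qquad\text{for all } n\in\mathbb N\text{ and } x\in K.$$ Then there are a map $\Phi:M\to X$, which sends $M$ into a single leaf $L$ and is smooth as a map $M\to L$, and a subsequence of $(\Phi_n)$ which converges to $\Phi$ in the $C^\infty_{\mathrm{loc}}$ topology, that is: it converges uniformly on the compact subsets of $M$, and for every chart $\psi$ of $M$, every laminated chart $\varphi_i$ and every compact set $K$ in the domain of $\psi$ with $\Phi(K)\subset U_i$, the coordinates $z_i\circ\Phi_n\circ\psi^{-1}$ of the subsequence converge, with all their derivatives, uniformly on $\psi(K)$ to $z_i\circ\Phi\circ\psi^{-1}$. -/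

import Mathlib

open Set Filter Topology
open scoped Manifold ContDiff

noncomputable section

/-! ### Laminations -/

/-- The open cube `(-1,1)^d` of `ℝ^d`. -/
def openCube (d : ℕ) : Set (EuclideanSpace ℝ (Fin d)) :=
  {z | ∀ a, z a ∈ Ioo (-1 : ℝ) 1}

/-- A function `f (z, t)` on a subset `W` of `V × T` (open in all uses below) is *smooth in `z`
and continuous in `t` for the `C^∞_loc` topology*: every `f (·, t)` is smooth on the slice
`W_t = {z | (z, t) ∈ W}`, and when `t → t₀`, all derivatives in `z` of `f (·, t)` converge to those
of `f (·, t₀)`, uniformly on the compact subsets of `W_{t₀}`. -/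
structure TransverselySmoothOn {V T V' : Type*} [NormedAddCommGroup V] [NormedSpace ℝ V]
    [TopologicalSpace T] [NormedAddCommGroup V'] [NormedSpace ℝ V']
    (f : V × T → V') (W : Set (V × T)) : Prop where
  smooth : ∀ t : T, ContDiffOn ℝ ∞ (fun z => f (z, t)) {z | (z, t) ∈ W}
  continuous : ∀ (k : ℕ) (t₀ : T) (K : Set V), IsCompact K → (∀ z ∈ K, (z, t₀) ∈ W) →
    TendstoUniformlyOn (fun (t : T) (z : V) => iteratedFDeriv ℝ k (fun z' => f (z', t)) z)
      (fun z => iteratedFDeriv ℝ k (fun z' => f (z', t₀)) z) (𝓝 t₀) K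

/-- A `d`-dimensional lamination of `X`, given by a laminated atlas `(U_i, T_i, φ_i)`: each `φ_i` is
a homeomorphism from an open set `U_i` onto `(-1,1)^d × T_i`, the `U_i` cover `X`, and
`φ_j ∘ φ_i⁻¹ (z, t) = (ζ_{ij} (z, t), τ_{ij} t)` with `τ_{ij}` a homeomorphism between open sets and
`ζ_{ij}` smooth in `z` and continuous in `t` for the `C^∞_loc` topology.  (As this is required for
`(i, j)` and for `(j, i)`, each `ζ_{ij} (·, t)` is a diffeomorphism onto its image.) -/
structure Lamination (d : ℕ) (X : Type*) [TopologicalSpace X] where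
  /-- indices of the charts -/
  ι : Type*
  /-- transversals -/
  T : ι → Type*
  [topT : ∀ i, TopologicalSpace (T i)]
  [metrizableT : ∀ i, TopologicalSpace.MetrizableSpace (T i)]
  /-- the laminated charts -/
  chart : ∀ i, OpenPartialHomeomorph X (EuclideanSpace ℝ (Fin d) × T i)
  target_eq : ∀ i, (chart i).target = openCube d ×ˢ univ
  cover : ∀ p : X, ∃ i, p ∈ (chart i).source
  transverse : ∀ i j, ∃ τ : OpenPartialHomeomorph (T i) (T j),
    ∀ p, p ∈ (chart i).source → p ∈ (chart j).source →
      (chart i p).2 ∈ τ.source ∧ (chart j p).2 = τ (chart i p).2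
  tangential : ∀ i j, TransverselySmoothOn
    (fun q : EuclideanSpace ℝ (Fin d) × T i => (chart j ((chart i).symm q)).1)
    {q | q ∈ (chart i).target ∧ (chart i).symm q ∈ (chart j).source}

attribute [instance] Lamination.topT Lamination.metrizableT

namespace Lamination

variable {d : ℕ} {X : Type*} [TopologicalSpace X] (𝓛 : Lamination d X)

/-- Two points lie in a common plaque `φ_i⁻¹ ((-1,1)^d × {t})`. -/
def SamePlaque (p q : X) : Prop :=
  ∃ i, p ∈ (𝓛.chart i).source ∧ q ∈ (𝓛.chart i).source ∧ (𝓛.chart i p).2 = (𝓛.chart i q).2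

/-- The leaf through `p`: all the points reached from `p` by a finite chain of plaques. -/
def leaf (p : X) : Set X := {q | Relation.EqvGen 𝓛.SamePlaque p q}

/-- The tangential coordinate of the chart `i`. -/
def tang (i : 𝓛.ι) (p : X) : EuclideanSpace ℝ (Fin d) := (𝓛.chart i p).1

/-- The transverse coordinate of the chart `i`. -/
def trans (i : 𝓛.ι) (p : X) : 𝓛.T i := (𝓛.chart i p).2

end Lamination

/-- A laminated Riemannian metric (of class `C^∞_l`), through its expressions in the laminated
charts: in the chart `i`, the metric of the leaf at the point of coordinates `(z, t)` is the inner
product `coeff i (z, t)` on `ℝ^d`.  These are smooth in the leaves and transversally continuous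
in the `C^∞_loc` topology, and the changes of charts transform them into one another, so
that they define a Riemannian metric on each leaf. -/
structure LaminatedMetric {d : ℕ} {X : Type*} [TopologicalSpace X] (𝓛 : Lamination d X) where
  coeff : ∀ i, EuclideanSpace ℝ (Fin d) × 𝓛.T i →
    EuclideanSpace ℝ (Fin d) →L[ℝ] EuclideanSpace ℝ (Fin d) →L[ℝ] ℝ
  symm : ∀ i, ∀ q ∈ (𝓛.chart i).target, ∀ u v, coeff i q u v = coeff i q v u
  pos : ∀ i, ∀ q ∈ (𝓛.chart i).target, ∀ u, u ≠ 0 → 0 < coeff i q u u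
  smooth : ∀ i, TransverselySmoothOn (coeff i) (𝓛.chart i).target
  compat : ∀ i j, ∀ p, p ∈ (𝓛.chart i).source → p ∈ (𝓛.chart j).source → ∀ u v,
    coeff i (𝓛.chart i p) u v =
      coeff j (𝓛.chart j p)
        (fderiv ℝ (fun z => 𝓛.tang j ((𝓛.chart i).symm (z, 𝓛.trans i p))) (𝓛.tang i p) u)
        (fderiv ℝ (fun z => 𝓛.tang j ((𝓛.chart i).symm (z, 𝓛.trans i p))) (𝓛.tang i p) v)

/-! ### Covariant derivatives in coordinates -/

section Covariant

variable {V W : Type*} [NormedAddCommGroup V] [NormedSpace ℝ V]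
  [NormedAddCommGroup W] [NormedSpace ℝ W]

/-- For a metric `G` on an open set of a vector space, the linear form
`w ↦ ½ (∂_u G (v, w) + ∂_v G (u, w) - ∂_w G (u, v))` at `z`. -/
def koszulForm (G : V → V →L[ℝ] V →L[ℝ] ℝ) (z u v : V) : V →L[ℝ] ℝ :=
  (1 / 2 : ℝ) • (fderiv ℝ G z u v + fderiv ℝ G z v u - ((fderiv ℝ G z).flip u).flip v)

/-- The Christoffel symbol `Γ_z (u, v)` of the Levi-Civita connection of `G`: the vector such that
`G_z (Γ_z (u, v), w) = koszulForm G z u v w` for all `w`. -/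
def christoffel (G : V → V →L[ℝ] V →L[ℝ] ℝ) (z u v : V) : V :=
  (G z).inverse (koszulForm G z u v)

/-- The iterated covariant derivatives of a map `f` between open sets of the vector spaces `V` and
`W` endowed with the metrics `G` and `G'`: `covDeriv G G' f k` is `D^{k+1} f`, where `D^1 f = df` and
`D^{k+1} f = ∇ (D^k f)`, for the connection on `(T^*V)^{⊗k} ⊗ f^* TW` induced by the two Levi-Civita
connections.  In coordinates,
`(D^{k+1} f) (v₀, …, v_k) = ∂_{v₀} (D^k f) (v₁, …, v_k) + Γ' (df v₀, (D^k f) (v₁, …, v_k))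
  - ∑ i, (D^k f) (v₁, …, Γ (v₀, v_i), …, v_k)`. -/
def covDeriv (G : V → V →L[ℝ] V →L[ℝ] ℝ) (G' : W → W →L[ℝ] W →L[ℝ] ℝ) (f : V → W) :
    (k : ℕ) → V → (Fin (k + 1) → V) → W
  | 0, x, v => fderiv ℝ f x (v 0)
  | k + 1, x, v =>
      fderiv ℝ (fun y => covDeriv G G' f k y (Fin.tail v)) x (v 0)
        + christoffel G' (f x) (fderiv ℝ f x (v 0)) (covDeriv G G' f k x (Fin.tail v))
        - ∑ i, covDeriv G G' f k x
            (Function.update (Fin.tail v) i (christoffel G x (v 0) (Fin.tail v i)))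

end Covariant

/-! ### Maps from a manifold to a lamination -/

section Maps

variable {m d : ℕ} {M : Type*} [TopologicalSpace M] [ChartedSpace (EuclideanSpace ℝ (Fin m)) M]
  {X : Type*} [TopologicalSpace X]

/-- The expression in a chart `e` of a Riemannian metric on `M`. -/
def metricInChart [IsManifold (𝓡 m) ∞ M]
    (g : Bundle.ContMDiffRiemannianMetric (𝓡 m) ∞ (EuclideanSpace ℝ (Fin m))
      (fun x : M => TangentSpace (𝓡 m) x))
    (e : OpenPartialHomeomorph M (EuclideanSpace ℝ (Fin m))) (y : EuclideanSpace ℝ (Fin m)) :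
    EuclideanSpace ℝ (Fin m) →L[ℝ] EuclideanSpace ℝ (Fin m) →L[ℝ] ℝ :=
  let A : EuclideanSpace ℝ (Fin m) →L[ℝ] EuclideanSpace ℝ (Fin m) :=
    mfderiv (𝓡 m) (𝓡 m) e.symm y
  let B : EuclideanSpace ℝ (Fin m) →L[ℝ] EuclideanSpace ℝ (Fin m) →L[ℝ] ℝ := g.inner (e.symm y)
  B.bilinearComp A A

/-- The map `Φ : M → X` sends `M` into a leaf, and is smooth as a map into this leaf: its image lies
in a leaf and, near each point and in each laminated chart, `Φ` takes its values in one
plaque and its tangential coordinate is smooth. -/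
def SmoothIntoLeaf (𝓛 : Lamination d X) (Φ : M → X) : Prop :=
  (∃ p : X, ∀ x, Φ x ∈ 𝓛.leaf p) ∧
  ∀ (x : M) (i : 𝓛.ι), Φ x ∈ (𝓛.chart i).source →
    (∀ᶠ y in 𝓝 x, Φ y ∈ (𝓛.chart i).source ∧ 𝓛.trans i (Φ y) = 𝓛.trans i (Φ x)) ∧
    ContMDiffAt (𝓡 m) (𝓡 d) ∞ (fun y => 𝓛.tang i (Φ y)) x

/-- `‖D^{k+1} Φ‖ ≤ A` at the point `x`, for the norm of multilinear maps defined by the metrics of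
`M` and of the leaf: `‖D^{k+1} Φ (v₀, …, v_k)‖ ≤ A ‖v₀‖ ⋯ ‖v_k‖`.  The left and right sides
do not depend on the charts `e` and `i` around `x` and `Φ x` in which they are written. -/
def CovDerivLE [IsManifold (𝓡 m) ∞ M]
    (gM : Bundle.ContMDiffRiemannianMetric (𝓡 m) ∞ (EuclideanSpace ℝ (Fin m))
      (fun x : M => TangentSpace (𝓡 m) x))
    {𝓛 : Lamination d X} (g : LaminatedMetric 𝓛) (Φ : M → X) (k : ℕ) (x : M) (A : ℝ) : Prop :=
  ∀ e ∈ atlas (EuclideanSpace ℝ (Fin m)) M, x ∈ e.source →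
  ∀ i, Φ x ∈ (𝓛.chart i).source →
  ∀ v : Fin (k + 1) → EuclideanSpace ℝ (Fin m),
    let w := covDeriv (metricInChart gM e) (fun z => g.coeff i (z, 𝓛.trans i (Φ x)))
      (fun y => 𝓛.tang i (Φ (e.symm y))) k (e x) v
    √(g.coeff i (𝓛.chart i (Φ x)) w w) ≤
      A * ∏ a, √(metricInChart gM e (e x) (v a) (v a))

/-- The convergence of `Φ_n` to `Φ` in the `C^∞_loc` topology: uniform convergence on the compact sets
(that is, convergence in the compact-open topology) and, in the charts of `M` and of the
lamination, uniform convergence on compact sets of the tangential coordinates and of all their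
derivatives. -/
def TendstoCInfLoc (𝓛 : Lamination d X) (Φ : ℕ → M → X) (Ψ : M → X) : Prop :=
  (∀ (K : Set M) (U : Set X), IsCompact K → IsOpen U → MapsTo Ψ K U →
    ∀ᶠ n in atTop, MapsTo (Φ n) K U) ∧
  ∀ e ∈ atlas (EuclideanSpace ℝ (Fin m)) M, ∀ (i : 𝓛.ι) (K : Set M), IsCompact K →
    K ⊆ e.source → MapsTo Ψ K (𝓛.chart i).source → ∀ k : ℕ,
    TendstoUniformlyOn
      (fun n y => iteratedFDeriv ℝ k (fun y' => 𝓛.tang i (Φ n (e.symm y'))) y)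
      (fun y => iteratedFDeriv ℝ k (fun y' => 𝓛.tang i (Ψ (e.symm y'))) y)
      atTop (e '' K)

end Maps

end

/-! The bounds are measured inside the leaves, whereas convergence takes place in `X`, where one
leaf may return near a point through infinitely many plaques. The two are reconciled by a continuity
argument. If `Φ_n(x₀)` is close to `p`, then in a laminated chart around `p` the leaf metrics are
uniformly comparable with the Euclidean one, so the bound on `DΦ_n` makes the tangential coordinate
Lipschitz as long as the image stays in its plaque. On a ball of radius independent of `n`, the
image then has no room to leave the plaque (`mem_plaque_of_norm_fderiv_le`,
`eventually_mem_plaque_and_tendsto`). With the compactness of `X` this yields equicontinuity, and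
Arzelà–Ascoli gives a subsequence converging uniformly on compact sets. Near each point the
transverse coordinates of late terms are constant, hence so is that of the limit; connectedness of
`M` puts its image in one leaf.

For higher derivatives, a covariant derivative in coordinates is an ordinary derivative plus terms
of lower order in Christoffel symbols. The leaf metric varies with `n`, but its transverse
continuity bounds the Christoffel symbols and their derivatives uniformly, so bounds on all `D^kΦ_n`
give bounds on all partial derivatives (`locBdd_of_covDeriv_bounded`). Finally, uniform convergence
together with bounds on the derivatives implies convergence of the derivatives, by interpolation
(`contDiffOn_and_tendstoUniformlyOnFilter_iteratedFDeriv`). -/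

/-! ### Locally uniform bounds on the derivatives of a family of maps -/

section LocBdd

variable {ι V W W' W'' : Type*} [NormedAddCommGroup V] [NormedSpace ℝ V]
  [NormedAddCommGroup W] [NormedSpace ℝ W] [NormedAddCommGroup W'] [NormedSpace ℝ W']
  [NormedAddCommGroup W''] [NormedSpace ℝ W'']

/-- Near `x` and along `l`, the maps `h n` are smooth and their derivatives up to order `j` are
uniformly bounded. -/
def LocBdd (l : Filter ι) (h : ι → V → W) (x : V) (j : ℕ) : Prop :=
  (∀ᶠ p in l ×ˢ 𝓝 x, ContDiffAt ℝ ∞ (h p.1) p.2) ∧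
    ∀ i ≤ j, ∃ C, ∀ᶠ p in l ×ˢ 𝓝 x, ‖iteratedFDeriv ℝ i (h p.1) p.2‖ ≤ C

/-- Turns identities at points into identities of germs, which can be differentiated. -/
theorem eventually_prod_nhds_eventually {α : Type*} [TopologicalSpace α] {l : Filter ι} {x : α}
    {P : ι → α → Prop} (h : ∀ᶠ p in l ×ˢ 𝓝 x, P p.1 p.2) :
    ∀ᶠ p in l ×ˢ 𝓝 x, ∀ᶠ y in 𝓝 p.2, P p.1 y := by
  obtain ⟨pa, ha, pb, hb, H⟩ := eventually_prod_iff.1 h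
  exact eventually_prod_iff.2 ⟨pa, ha, _, hb.eventually_nhds, fun hx _ hy => hy.mono fun z hz => H hx hz⟩

theorem exists_isOpen_contDiffOn {f : V → W} {x : V} {n : ℕ} (hf : ContDiffAt ℝ n f x) :
    ∃ O, IsOpen O ∧ x ∈ O ∧ ContDiffOn ℝ n f O := by
  have h := hf.eventually (by simp)
  obtain ⟨O, hO, h1, h2⟩ := eventually_nhds_iff.1 h
  exact ⟨O, h1, h2, fun y hy => (hO y hy).contDiffWithinAt⟩

/-- The Leibniz bound for derivatives within a set, applied on an open neighbourhood, where they are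
the ordinary ones. -/
theorem norm_iteratedFDeriv_bilinear_le (B : W →L[ℝ] W' →L[ℝ] W'') {f : V → W} {g : V → W'} {x : V}
    {n : ℕ} (hf : ContDiffAt ℝ n f x) (hg : ContDiffAt ℝ n g x) :
    ‖iteratedFDeriv ℝ n (fun y => B (f y) (g y)) x‖ ≤
      ‖B‖ * ∑ i ∈ Finset.range (n + 1), (n.choose i : ℝ) * ‖iteratedFDeriv ℝ i f x‖ *
        ‖iteratedFDeriv ℝ (n - i) g x‖ := by
  obtain ⟨O, hO, hx, h1⟩ := exists_isOpen_contDiffOn hf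
  obtain ⟨O', hO', hx', h2⟩ := exists_isOpen_contDiffOn hg
  have := B.norm_iteratedFDerivWithin_le_of_bilinear (h1.mono inter_subset_left)
    (h2.mono inter_subset_right) (hO.inter hO').uniqueDiffOn (mem_inter hx hx') (n := n) le_rfl
  simpa only [iteratedFDerivWithin_of_isOpen _ (hO.inter hO') (mem_inter hx hx')] using this

theorem norm_iteratedFDeriv_comp_at_le {g : W → W'} {f : V → W} {x : V} {n : ℕ}
    (hg : ContDiffAt ℝ n g (f x)) (hf : ContDiffAt ℝ n f x) {C D : ℝ}
    (hC : ∀ i, i ≤ n → ‖iteratedFDeriv ℝ i g (f x)‖ ≤ C)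
    (hD : ∀ i, 1 ≤ i → i ≤ n → ‖iteratedFDeriv ℝ i f x‖ ≤ D ^ i) :
    ‖iteratedFDeriv ℝ n (fun y => g (f y)) x‖ ≤ n.factorial * C * D ^ n := by
  obtain ⟨O, hO, hx, h1⟩ := exists_isOpen_contDiffOn hf
  obtain ⟨O', hO', hx', h2⟩ := exists_isOpen_contDiffOn hg
  have hOO : IsOpen (O ∩ f ⁻¹' O') := h1.continuousOn.isOpen_inter_preimage hO hO'
  have hm : x ∈ O ∩ f ⁻¹' O' := ⟨hx, hx'⟩
  have := norm_iteratedFDerivWithin_comp_le (n := n) h2 (h1.mono inter_subset_left) le_rfl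
    hO'.uniqueDiffOn hOO.uniqueDiffOn (fun y hy => hy.2) hm (C := C) (D := D)
    (fun i hi => by simpa only [iteratedFDerivWithin_of_isOpen _ hO' hx'] using hC i hi)
    (fun i hi hi' => by simpa only [iteratedFDerivWithin_of_isOpen _ hOO hm] using hD i hi hi')
  rw [iteratedFDerivWithin_of_isOpen _ hOO hm] at this
  exact this

namespace LocBdd

variable {l : Filter ι} {h h' : ι → V → W} {x : V} {j : ℕ}

theorem congr (H : LocBdd l h x j) (e : ∀ᶠ p in l ×ˢ 𝓝 x, h p.1 p.2 = h' p.1 p.2) :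
    LocBdd l h' x j := by
  have e' := eventually_prod_nhds_eventually (P := fun n y => h n y = h' n y) e
  refine ⟨?_, fun i hi => ?_⟩
  · filter_upwards [H.1, e'] with p h1 h2
    exact h1.congr_of_eventuallyEq (EventuallyEq.symm h2)
  · obtain ⟨C, hC⟩ := H.2 i hi
    refine ⟨C, ?_⟩
    filter_upwards [hC, e'] with p h1 h2
    have : h p.1 =ᶠ[𝓝 p.2] h' p.1 := h2
    rwa [← (this.iteratedFDeriv ℝ i).eq_of_nhds]

theorem mono (H : LocBdd l h x j) {i : ℕ} (hi : i ≤ j) : LocBdd l h x i :=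
  ⟨H.1, fun i' hi' => H.2 i' (hi'.trans hi)⟩

/-- A common bound for all the derivatives up to order `j`. -/
theorem exists_bound (H : LocBdd l h x j) :
    ∃ C, 1 ≤ C ∧ ∀ᶠ p in l ×ˢ 𝓝 x, ∀ i ≤ j, ‖iteratedFDeriv ℝ i (h p.1) p.2‖ ≤ C := by
  choose! C hC using H.2
  refine ⟨1 + ∑ i ∈ Finset.range (j + 1), |C i|, ?_, ?_⟩
  · have : 0 ≤ ∑ i ∈ Finset.range (j + 1), |C i| := Finset.sum_nonneg fun i _ => abs_nonneg _
    linarith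
  · have : ∀ᶠ p in l ×ˢ 𝓝 x, ∀ i ∈ Finset.range (j + 1), ‖iteratedFDeriv ℝ i (h p.1) p.2‖ ≤ C i :=
      (Finset.eventually_all _).2 fun i hi => hC i (by simpa [Nat.lt_succ_iff] using hi)
    filter_upwards [this] with p hp i hi
    have hi' : i ∈ Finset.range (j + 1) := by simpa [Nat.lt_succ_iff] using hi
    have h1 := Finset.single_le_sum (f := fun i => |C i|) (fun i _ => abs_nonneg _) hi'
    have h2 := hp i hi'
    have h3 := le_abs_self (C i)
    linarith

theorem bilinear (B : W →L[ℝ] W' →L[ℝ] W'') (H : LocBdd l h x j) {g : ι → V → W'}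
    (H' : LocBdd l g x j) : LocBdd l (fun n y => B (h n y) (g n y)) x j := by
  obtain ⟨C, hC1, hC⟩ := H.exists_bound
  obtain ⟨D, hD1, hD⟩ := H'.exists_bound
  refine ⟨?_, fun i hi => ?_⟩
  · filter_upwards [H.1, H'.1] with p h1 h2
    exact (B.contDiff.contDiffAt.comp p.2 h1).clm_apply h2
  · refine ⟨‖B‖ * ∑ k ∈ Finset.range (i + 1), (i.choose k : ℝ) * C * D, ?_⟩
    filter_upwards [H.1, H'.1, hC, hD] with p h1 h2 h3 h4
    refine (norm_iteratedFDeriv_bilinear_le B (h1.of_le (by exact_mod_cast le_top))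
      (h2.of_le (by exact_mod_cast le_top))).trans ?_
    gcongr with k hk
    · exact h3 k (by simp at hk; omega)
    · exact h4 _ (by omega)

/-- By `ht`, the map `(n, y) ↦ (n, h n y)` sends `l ×ˢ 𝓝 x` to `l ×ˢ 𝓝 z`, so the bounds on `g` pull
back, and the Faà di Bruno estimate concludes. -/
theorem comp (H : LocBdd l h x j) {g : ι → W → W'} {z : W} (H' : LocBdd l g z j)
    (ht : Tendsto (fun p : ι × V => h p.1 p.2) (l ×ˢ 𝓝 x) (𝓝 z)) :
    LocBdd l (fun n y => g n (h n y)) x j := by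
  have ht' : Tendsto (fun p : ι × V => (p.1, h p.1 p.2)) (l ×ˢ 𝓝 x) (l ×ˢ 𝓝 z) :=
    tendsto_fst.prodMk ht
  obtain ⟨C, hC1, hC⟩ := H.exists_bound
  obtain ⟨D, hD1, hD⟩ := H'.exists_bound
  refine ⟨?_, fun i hi => ?_⟩
  · filter_upwards [H.1, ht'.eventually H'.1] with p h1 h2
    exact ContDiffAt.comp p.2 h2 h1
  · refine ⟨i.factorial * D * C ^ i, ?_⟩
    filter_upwards [H.1, ht'.eventually H'.1, hC, ht'.eventually hD] with p h1 h2 h3 h4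
    refine norm_iteratedFDeriv_comp_at_le (h2.of_le (by exact_mod_cast le_top))
      (h1.of_le (by exact_mod_cast le_top)) (fun k hk => h4 k (hk.trans hi)) fun k hk hk' => ?_
    -- The estimate wants the `k`-th derivative bounded by a `k`-th power, hence the normalization
    -- `1 ≤ C` in `exists_bound`.
    exact (h3 k (hk'.trans hi)).trans (le_self_pow₀ hC1 (by omega))

theorem of_fixed {f : V → W} (hf : ∀ᶠ y in 𝓝 x, ContDiffAt ℝ ∞ f y) :
    LocBdd l (fun _ => f) x j := by
  refine ⟨hf.prod_inr l, fun i _ => ?_⟩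
  have : ContinuousAt (fun y => ‖iteratedFDeriv ℝ i f y‖) x :=
    (hf.self_of_nhds.continuousAt_iteratedFDeriv (by exact_mod_cast le_top)).norm
  refine ⟨‖iteratedFDeriv ℝ i f x‖ + 1, ?_⟩
  exact ((this.eventually_lt continuousAt_const (lt_add_one _)).mono fun y hy => le_of_lt hy).prod_inr l

theorem clm (B : W →L[ℝ] W') (H : LocBdd l h x j) : LocBdd l (fun n y => B (h n y)) x j := by
  have := bilinear (ContinuousLinearMap.apply ℝ W').flip
    (of_fixed (f := fun _ => B) (l := l) (x := x) (j := j)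
      (Eventually.of_forall fun y => contDiffAt_const)) H
  simpa using! this

theorem const (c : W) : LocBdd l (fun _ (_ : V) => c) x j :=
  of_fixed (Eventually.of_forall fun _ => contDiffAt_const)

theorem add (H : LocBdd l h x j) (H' : LocBdd l h' x j) :
    LocBdd l (fun n y => h n y + h' n y) x j := by
  refine ⟨?_, fun i hi => ?_⟩
  · filter_upwards [H.1, H'.1] with p h1 h2
    exact h1.add h2
  · obtain ⟨C, hC⟩ := H.2 i hi
    obtain ⟨D, hD⟩ := H'.2 i hi
    refine ⟨C + D, ?_⟩
    filter_upwards [H.1, H'.1, hC, hD] with p h1 h2 h3 h4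
    have : iteratedFDeriv ℝ i (fun y => h p.1 y + h' p.1 y) p.2 =
        iteratedFDeriv ℝ i (h p.1) p.2 + iteratedFDeriv ℝ i (h' p.1) p.2 :=
      iteratedFDeriv_add_apply (f := h p.1) (g := h' p.1)
        (h1.of_le (by exact_mod_cast le_top)) (h2.of_le (by exact_mod_cast le_top))
    rw [this]
    exact (norm_add_le _ _).trans (add_le_add h3 h4)

theorem neg (H : LocBdd l h x j) : LocBdd l (fun n y => - h n y) x j := by
  simpa using! H.clm (-ContinuousLinearMap.id ℝ W)

theorem sub (H : LocBdd l h x j) (H' : LocBdd l h' x j) :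
    LocBdd l (fun n y => h n y - h' n y) x j := by
  simpa [sub_eq_add_neg] using H.add H'.neg

theorem sum {κ : Type*} (s : Finset κ) {h : κ → ι → V → W} (H : ∀ a ∈ s, LocBdd l (h a) x j) :
    LocBdd l (fun n y => ∑ a ∈ s, h a n y) x j := by
  classical
  induction s using Finset.induction_on with
  | empty => simpa using const (0 : W)
  | insert a s ha ih =>
    simp only [Finset.sum_insert ha]
    exact (H a (by simp)).add (ih fun b hb => H b (by simp [hb]))

theorem fderiv (H : LocBdd l h x (j + 1)) : LocBdd l (fun n => fderiv ℝ (h n)) x j := by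
  refine ⟨?_, fun i hi => ?_⟩
  · filter_upwards [H.1] with p h1
    exact h1.fderiv_right (by simp)
  · obtain ⟨C, hC⟩ := H.2 (i + 1) (by omega)
    refine ⟨C, ?_⟩
    simpa only [norm_iteratedFDeriv_fderiv] using hC

theorem of_fderiv (H : LocBdd l h x 0) (H' : LocBdd l (fun n => _root_.fderiv ℝ (h n)) x j) :
    LocBdd l h x (j + 1) := by
  refine ⟨H.1, fun i hi => ?_⟩
  cases i with
  | zero => exact H.2 0 le_rfl
  | succ i =>
    obtain ⟨C, hC⟩ := H'.2 i (by omega)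
    refine ⟨C, ?_⟩
    simpa only [norm_iteratedFDeriv_fderiv] using hC

/-- In a basis `b`, the derivative is the sum of its values at `b a` times the coordinate forms, so
fixed directions suffice. -/
theorem of_fderiv_apply [FiniteDimensional ℝ V] (H : LocBdd l h x 0)
    (H' : ∀ u, LocBdd l (fun n y => _root_.fderiv ℝ (h n) y u) x j) : LocBdd l h x (j + 1) := by
  refine H.of_fderiv ?_
  let b := Module.finBasis ℝ V
  have key := sum (Finset.univ) (fun a _ => (H' (b a)).clm
    (ContinuousLinearMap.smulRightL ℝ V W (LinearMap.toContinuousLinearMap (b.coord a))))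
  refine key.congr (Eventually.of_forall fun p => ?_)
  ext v
  conv_rhs => rw [← b.sum_repr v, map_sum]
  simp

end LocBdd

end LocBdd

/-! ### From uniform convergence to convergence of all derivatives -/

section Convergence

universe u

/-- Over a step `s • v`, the linear part differs from the increment of `f`, at most `2 * δ`, by at
most `B * s`; divide by `s`. -/
theorem norm_fderiv_le_of_interpolation {V W : Type*} [NormedAddCommGroup V] [NormedSpace ℝ V]
    [NormedAddCommGroup W] [NormedSpace ℝ W] {f : V → W} {x : V} {s B δ : ℝ} (hs : 0 < s)
    (hB : 0 ≤ B) (hf : ∀ y ∈ Metric.closedBall x s, DifferentiableAt ℝ f y)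
    (hf' : ∀ y ∈ Metric.closedBall x s, ‖fderiv ℝ f y - fderiv ℝ f x‖ ≤ B)
    (hδ : ∀ y ∈ Metric.closedBall x s, ‖f y‖ ≤ δ) : ‖fderiv ℝ f x‖ ≤ 2 * δ / s + B := by
  have hx : x ∈ Metric.closedBall x s := Metric.mem_closedBall_self hs.le
  have hδ0 : 0 ≤ δ := (norm_nonneg _).trans (hδ x hx)
  refine ContinuousLinearMap.opNorm_le_of_unit_norm (by positivity) fun v hv => ?_
  have hy : x + s • v ∈ Metric.closedBall x s := by
    simp [norm_smul, hv, abs_of_pos hs]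
  have h1 := (convex_closedBall x s).norm_image_sub_le_of_norm_fderiv_le' hf hf' hx hy
  have h2 : ‖fderiv ℝ f x (s • v)‖ ≤ 2 * δ + B * s := by
    have e : fderiv ℝ f x (s • v) =
      f (x + s • v) - f x - (f (x + s • v) - f x - fderiv ℝ f x (x + s • v - x)) := by
        rw [add_sub_cancel_left]; abel
    have h3 : ‖x + s • v - x‖ = s := by simp [norm_smul, hv, abs_of_pos hs]
    rw [h3] at h1
    rw [e]
    calc _ ≤ ‖f (x + s • v) - f x‖ + B * s := (norm_sub_le _ _).trans (by gcongr)
      _ ≤ (‖f (x + s • v)‖ + ‖f x‖) + B * s := by gcongr; exact norm_sub_le _ _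
      _ ≤ (δ + δ) + B * s := by gcongr; exacts [hδ _ hy, hδ _ hx]
      _ = _ := by ring
  rw [map_smul, norm_smul, Real.norm_eq_abs, abs_of_pos hs] at h2
  rw [div_add' _ _ _ hs.ne', le_div_iff₀ hs]
  linarith

theorem uniformCauchySeqOnFilter_fderiv {ι V W : Type*} [NormedAddCommGroup V] [NormedSpace ℝ V]
    [NormedAddCommGroup W] [NormedSpace ℝ W] {l : Filter ι} {f : ι → V → W} {g : V → W} {x : V}
    (hb : LocBdd l f x 2) {r : ℝ} (hr : 0 < r)
    (hf : TendstoUniformlyOn f g l (Metric.closedBall x r)) :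
    UniformCauchySeqOnFilter (fun n => fderiv ℝ (f n)) l (𝓝 x) := by
  obtain ⟨C, hC1, hC⟩ := hb.exists_bound
  obtain ⟨S, hS, Q, hQ, H⟩ := eventually_prod_iff.1 (hb.1.and hC)
  obtain ⟨r₁, hr₁, hr₁Q⟩ := Metric.eventually_nhds_iff_ball.1 hQ
  intro U hU
  obtain ⟨ε, hε, hεU⟩ := Metric.mem_uniformity_dist.1 hU
  -- Interpolation is applied to `f n - f m`. Its derivative varies by at most `2 * C * s ≤ ε / 4`
  -- on balls of radius `s`; once `s` is fixed, values below `s * ε / 8` contribute another `ε / 4`.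
  obtain ⟨s, hs0, hs1, hs2, hs3⟩ : ∃ s : ℝ, 0 < s ∧ s ≤ r₁ / 2 ∧ s ≤ r / 2 ∧ 2 * C * s ≤ ε / 4 := by
    refine ⟨min (min (r₁ / 2) (r / 2)) (ε / (8 * C)), by positivity,
      (min_le_left _ _).trans (min_le_left _ _), (min_le_left _ _).trans (min_le_right _ _), ?_⟩
    have : min (min (r₁ / 2) (r / 2)) (ε / (8 * C)) ≤ ε / (8 * C) := min_le_right _ _
    rw [le_div_iff₀ (by positivity)] at this
    linarith
  have hδ : (0:ℝ) < s * ε / 8 := by positivity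
  have hE := hf.uniformCauchySeqOn _ (Metric.dist_mem_uniformity hδ)
  have hE' : ∀ᶠ m : ι × ι in l ×ˢ l, S m.1 ∧ S m.2 := hS.prod_mk hS
  have hV : ∀ᶠ y in 𝓝 x, y ∈ Metric.ball x s := Metric.ball_mem_nhds x hs0
  filter_upwards [(hE.and hE').prod_mk hV]
  rintro ⟨⟨n, m⟩, y⟩ ⟨⟨h1, h2, h3⟩, hy⟩
  simp only at h1 h2 h3 hy
  have hsub1 : Metric.closedBall y s ⊆ Metric.ball x r₁ := fun z hz => by
    have := dist_triangle z y x
    simp only [Metric.mem_closedBall, Metric.mem_ball] at *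
    linarith
  have hsub2 : Metric.closedBall y s ⊆ Metric.closedBall x r := fun z hz => by
    have := dist_triangle z y x
    simp only [Metric.mem_closedBall, Metric.mem_ball] at *
    linarith
  have hd : ∀ k, S k → ∀ z ∈ Metric.closedBall y s, DifferentiableAt ℝ (f k) z := fun k hk z hz =>
    (H hk (hr₁Q z (hsub1 hz))).1.differentiableAt (by simp)
  have hL : ∀ k, S k → ∀ z ∈ Metric.closedBall y s,
      ‖fderiv ℝ (f k) z - fderiv ℝ (f k) y‖ ≤ C * s := fun k hk z hz => by
    have hyy : y ∈ Metric.closedBall y s := Metric.mem_closedBall_self hs0.le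
    refine ((convex_closedBall y s).norm_image_sub_le_of_norm_fderiv_le (𝕜 := ℝ) (C := C)
      (fun w hw => ?_) (fun w hw => ?_) hyy hz).trans ?_
    · exact ((H hk (hr₁Q w (hsub1 hw))).1.fderiv_right (m := ∞) (by simp)).differentiableAt (by simp)
    · have := (H hk (hr₁Q w (hsub1 hw))).2 2 le_rfl
      rwa [← norm_iteratedFDeriv_fderiv, ← norm_iteratedFDeriv_fderiv, norm_iteratedFDeriv_zero] at this
    · gcongr
      simpa [dist_eq_norm] using hz
  have hyy : y ∈ Metric.closedBall y s := Metric.mem_closedBall_self hs0.le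
  have hsub : ∀ z ∈ Metric.closedBall y s,
      fderiv ℝ (fun z => f n z - f m z) z = fderiv ℝ (f n) z - fderiv ℝ (f m) z := fun z hz =>
    fderiv_fun_sub (hd n h2 z hz) (hd m h3 z hz)
  have key := norm_fderiv_le_of_interpolation (f := fun z => f n z - f m z) (x := y) (s := s)
    (B := 2 * C * s) (δ := s * ε / 8) hs0 (by positivity)
    (fun z hz => (hd n h2 z hz).sub (hd m h3 z hz))
    (fun z hz => by
      rw [hsub z hz, hsub y hyy, sub_sub_sub_comm]
      refine (norm_sub_le _ _).trans ?_
      linarith [hL n h2 z hz, hL m h3 z hz])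
    (fun z hz => by
      have := h1 z (hsub2 hz)
      rw [dist_eq_norm] at this
      exact this.le)
  rw [hsub y hyy] at key
  apply hεU
  rw [dist_eq_norm]
  refine key.trans_lt ?_
  have : 2 * (s * ε / 8) / s = ε / 4 := by field_simp; norm_num
  rw [this]
  linarith

/-- Completeness turns the Cauchy property into a limit of the derivatives, which is the derivative
of the limit because the convergence is locally uniform. -/
theorem tendstoUniformlyOnFilter_fderiv {ι V W : Type*} [NormedAddCommGroup V] [NormedSpace ℝ V]
    [ProperSpace V] [NormedAddCommGroup W] [NormedSpace ℝ W] [CompleteSpace W] {l : Filter ι}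
    [l.NeBot] {f : ι → V → W} {g : V → W} {U : Set V} (hU : IsOpen U)
    (hb : ∀ x ∈ U, LocBdd l f x 2) (hf : ∀ x ∈ U, TendstoUniformlyOnFilter f g l (𝓝 x)) :
    ∀ x ∈ U, DifferentiableAt ℝ g x ∧
      TendstoUniformlyOnFilter (fun n => fderiv ℝ (f n)) (fderiv ℝ g) l (𝓝 x) := by
  have hloc : TendstoLocallyUniformlyOn f g l U :=
    tendstoLocallyUniformlyOn_iff_filter.2 fun x hx => by
      rw [hU.nhdsWithin_eq hx]; exact hf x hx
  have hC : ∀ x ∈ U, UniformCauchySeqOnFilter (fun n => fderiv ℝ (f n)) l (𝓝 x) := fun x hx => by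
    obtain ⟨r, hr, hrU⟩ := Metric.nhds_basis_closedBall.mem_iff.1 (hU.mem_nhds hx)
    exact uniformCauchySeqOnFilter_fderiv (hb x hx) hr
      ((tendstoLocallyUniformlyOn_iff_forall_isCompact hU).1 hloc _ hrU (isCompact_closedBall x r))
  have hlim : ∀ x ∈ U, ∃ g', Tendsto (fun n => fderiv ℝ (f n) x) l (𝓝 g') := fun x hx =>
    cauchy_map_iff_exists_tendsto.1 (((uniformCauchySeqOn_iff_uniformCauchySeqOnFilter (s := {x})).2
      ((hC x hx).mono_right (by simp [pure_le_nhds x]))).cauchy_map rfl)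
  choose! g' hg' using hlim
  have hT : ∀ x ∈ U, TendstoUniformlyOnFilter (fun n => fderiv ℝ (f n)) g' l (𝓝 x) := fun x hx =>
    (hC x hx).tendstoUniformlyOnFilter_of_tendsto
      (by filter_upwards [hU.mem_nhds hx] with y hy using hg' y hy)
  have hD : ∀ x ∈ U, HasFDerivAt g (g' x) x := fun x hx =>
    hasFDerivAt_of_tendstoUniformlyOnFilter (hT x hx)
      ((hb x hx).1.mono fun p hp => (hp.differentiableAt (by simp)).hasFDerivAt)
      (by filter_upwards [hU.mem_nhds hx] with y hy using hloc.tendsto_at hy)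
  refine fun x hx => ⟨(hD x hx).differentiableAt, fun u hu => ?_⟩
  filter_upwards [hT x hx u hu, Eventually.prod_inr (hU.mem_nhds hx) l] with p h1 h2
  rwa [(hD p.2 h2).fderiv]

/-- Locally uniform convergence of smooth maps with locally bounded derivatives is convergence of
all the derivatives, to a smooth limit. -/
theorem contDiffOn_and_tendstoUniformlyOnFilter_iteratedFDeriv {ι : Type*} {V W : Type u}
    [NormedAddCommGroup V] [NormedSpace ℝ V] [ProperSpace V] [NormedAddCommGroup W]
    [NormedSpace ℝ W] [CompleteSpace W] {l : Filter ι} [l.NeBot] {f : ι → V → W} {g : V → W}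
    {U : Set V} (hU : IsOpen U) (hb : ∀ x ∈ U, ∀ j, LocBdd l f x j)
    (hf : ∀ x ∈ U, TendstoUniformlyOnFilter f g l (𝓝 x)) (k : ℕ) :
    ContDiffOn ℝ k g U ∧ ∀ x ∈ U, TendstoUniformlyOnFilter
      (fun n => iteratedFDeriv ℝ k (f n)) (iteratedFDeriv ℝ k g) l (𝓝 x) := by
  have hcont : ContinuousOn g U := fun x hx => ((tendstoUniformlyOnFilter_fderiv hU
    (fun x hx => hb x hx 2) hf x hx).1.continuousAt).continuousWithinAt
  -- The inductive step passes to derivatives, with values in `V →L[ℝ] W`; this space must live in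
  -- the universe of `W`, whence the common universe of `V` and `W`.
  induction k generalizing W with
  | zero =>
    refine ⟨by exact_mod_cast (contDiffOn_zero (𝕜 := ℝ)).2 hcont, fun x hx => ?_⟩
    rw [Metric.tendstoUniformlyOnFilter_iff]
    intro ε hε
    filter_upwards [Metric.tendstoUniformlyOnFilter_iff.1 (hf x hx) ε hε] with p hp
    simp only [iteratedFDeriv_zero_eq_comp, Function.comp_apply, LinearIsometryEquiv.dist_map]
    exact hp
  | succ k ih =>
    have H := tendstoUniformlyOnFilter_fderiv hU (fun x hx => hb x hx 2) hf
    have hb' : ∀ x ∈ U, ∀ j, LocBdd l (fun n => fderiv ℝ (f n)) x j :=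
      fun x hx j => (hb x hx (j + 1)).fderiv
    have hc' : ContinuousOn (fderiv ℝ g) U := fun x hx => ((tendstoUniformlyOnFilter_fderiv hU
      (fun x hx => hb' x hx 2) (fun x hx => (H x hx).2) x hx).1.continuousAt).continuousWithinAt
    obtain ⟨h1, h2⟩ := ih hb' (fun x hx => (H x hx).2) hc'
    refine ⟨?_, fun x hx => ?_⟩
    · push_cast
      refine (contDiffOn_succ_iff_fderiv_of_isOpen hU).2
        ⟨fun x hx => (H x hx).1.differentiableWithinAt, by simp, h1⟩
    · rw [Metric.tendstoUniformlyOnFilter_iff]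
      intro ε hε
      filter_upwards [Metric.tendstoUniformlyOnFilter_iff.1 (h2 x hx) ε hε] with p hp
      simp only [iteratedFDeriv_succ_eq_comp_right, Function.comp_apply,
        LinearIsometryEquiv.dist_map]
      exact hp

end Convergence

/-! ### From covariant derivatives to partial derivatives -/

section CovariantBounds

set_option maxSynthPendingDepth 3

section Christoffel

variable {V : Type*} [NormedAddCommGroup V] [NormedSpace ℝ V]

/-- The Koszul form as a continuous linear function of the derivative of the metric. -/
noncomputable def koszulCLM (V : Type*) [NormedAddCommGroup V] [NormedSpace ℝ V] :
    (V →L[ℝ] V →L[ℝ] V →L[ℝ] ℝ) →L[ℝ] (V →L[ℝ] V →L[ℝ] V →L[ℝ] ℝ) :=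
  let F : (V →L[ℝ] V →L[ℝ] V →L[ℝ] ℝ) →L[ℝ] (V →L[ℝ] V →L[ℝ] V →L[ℝ] ℝ) :=
    (ContinuousLinearMap.flipₗᵢ ℝ V V (V →L[ℝ] ℝ)).toContinuousLinearEquiv
  let F' : (V →L[ℝ] V →L[ℝ] ℝ) →L[ℝ] (V →L[ℝ] V →L[ℝ] ℝ) :=
    (ContinuousLinearMap.flipₗᵢ ℝ V V ℝ).toContinuousLinearEquiv
  (1 / 2 : ℝ) • (ContinuousLinearMap.id ℝ _ + F - (ContinuousLinearMap.compL ℝ V _ _ F').comp F)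

/-- The Christoffel symbol as a continuous bilinear map. -/
noncomputable def christoffelCLM (G : V → V →L[ℝ] V →L[ℝ] ℝ) (z : V) : V →L[ℝ] V →L[ℝ] V :=
  ContinuousLinearMap.compL ℝ V (V →L[ℝ] V →L[ℝ] ℝ) (V →L[ℝ] V)
    (ContinuousLinearMap.compL ℝ V (V →L[ℝ] ℝ) V (G z).inverse) (koszulCLM V (fderiv ℝ G z))

theorem christoffelCLM_apply (G : V → V →L[ℝ] V →L[ℝ] ℝ) (z u v : V) :
    christoffelCLM G z u v = christoffel G z u v := by
  simp [christoffelCLM, christoffel, koszulCLM, koszulForm]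

theorem ContinuousLinearMap.IsInvertible.eventually_nhds {E F : Type*} [NormedAddCommGroup E]
    [NormedSpace ℝ E] [CompleteSpace E] [NormedAddCommGroup F] [NormedSpace ℝ F] {A : E →L[ℝ] F}
    (hA : A.IsInvertible) : ∀ᶠ B in 𝓝 A, B.IsInvertible := by
  obtain ⟨e, rfl⟩ := hA
  exact e.nhds

theorem contDiffAt_christoffelCLM [CompleteSpace V] {G : V → V →L[ℝ] V →L[ℝ] ℝ} {z : V}
    (hG : ContDiffAt ℝ ∞ G z) (hi : (G z).IsInvertible) : ContDiffAt ℝ ∞ (christoffelCLM G) z := by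
  have h1 : ContDiffAt ℝ ∞ (fun y => (G y).inverse) z :=
    ContDiffAt.comp z hi.contDiffAt_map_inverse hG
  have h2 : ContDiffAt ℝ ∞ (fun y => koszulCLM V (fderiv ℝ G y)) z :=
    (koszulCLM V).contDiff.contDiffAt.comp z (hG.fderiv_right (by simp))
  have h3 := (ContinuousLinearMap.compL ℝ V (V →L[ℝ] ℝ) V).contDiff.contDiffAt.comp z h1
  exact ((ContinuousLinearMap.compL ℝ V (V →L[ℝ] V →L[ℝ] ℝ) (V →L[ℝ] V)).contDiff.contDiffAt.comp
    z h3).clm_apply h2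

/-- Inversion is one fixed smooth map near the invertible limit `G₀`, so composing with it preserves
uniform bounds. -/
theorem LocBdd.christoffelCLM [CompleteSpace V] {ι : Type*} {l : Filter ι}
    {G : ι → V → V →L[ℝ] V →L[ℝ] ℝ} {z : V} {G₀ : V →L[ℝ] V →L[ℝ] ℝ} (hG : ∀ j, LocBdd l G z j)
    (ht : Tendsto (fun p : ι × V => G p.1 p.2) (l ×ˢ 𝓝 z) (𝓝 G₀)) (hi : G₀.IsInvertible) (j : ℕ) :
    LocBdd l (fun n => christoffelCLM (G n)) z j := by
  have h1 : LocBdd l (fun n y => (G n y).inverse) z j :=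
    (hG j).comp (LocBdd.of_fixed (hi.eventually_nhds.mono fun B hB => hB.contDiffAt_map_inverse)) ht
  have h2 := (hG (j + 1)).fderiv.clm (koszulCLM V)
  exact LocBdd.bilinear _ (h1.clm (ContinuousLinearMap.compL ℝ V (V →L[ℝ] ℝ) V)) h2

end Christoffel

variable {V W : Type*} [NormedAddCommGroup V] [NormedSpace ℝ V] [FiniteDimensional ℝ V]
  [NormedAddCommGroup W] [NormedSpace ℝ W] [CompleteSpace W]

/-- The map `f` and the two metrics are smooth and the metrics are nondegenerate at `x`, `f x`. -/
structure RegularAt (G : V → V →L[ℝ] V →L[ℝ] ℝ) (G' : W → W →L[ℝ] W →L[ℝ] ℝ) (f : V → W)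
    (x : V) : Prop where
  map : ContDiffAt ℝ ∞ f x
  source : ContDiffAt ℝ ∞ G x
  source_inv : (G x).IsInvertible
  target : ContDiffAt ℝ ∞ G' (f x)
  target_inv : (G' (f x)).IsInvertible

variable {G : V → V →L[ℝ] V →L[ℝ] ℝ} {G' : W → W →L[ℝ] W →L[ℝ] ℝ} {f : V → W}

-- Used to trade an argument `Γ_y (u, v_i)`, which moves with `y`, for scalar functions of `y` times
-- values at fixed vectors.
omit [CompleteSpace W] in
theorem MultilinearMap.map_update_basis {k : ℕ} (F : MultilinearMap ℝ (fun _ : Fin k => V) W)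
    (v : Fin k → V) (i : Fin k) (w : V) :
    F (Function.update v i w) = ∑ a, (Module.finBasis ℝ V).repr w a •
      F (Function.update v i (Module.finBasis ℝ V a)) := by
  conv_lhs => rw [← (Module.finBasis ℝ V).sum_repr w]
  rw [F.map_update_sum]
  simp [F.map_update_smul]

/-- The two claims need each other: smoothness at level `k + 1` expands the moving argument by
multilinearity at level `k`, and multilinearity at level `k + 1` differentiates a sum of terms of
level `k`. -/
theorem covDeriv_multilinear_and_contDiffAt (k : ℕ) :
    ∀ {x : V}, (∀ᶠ y in 𝓝 x, RegularAt G G' f y) →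
    (∃ F : MultilinearMap ℝ (fun _ : Fin (k + 1) => V) W, ⇑F = covDeriv G G' f k x) ∧
      ∀ v, ContDiffAt ℝ ∞ (fun y => covDeriv G G' f k y v) x := by
  induction k with
  | zero =>
    intro x h
    have hx := h.self_of_nhds
    refine ⟨⟨MultilinearMap.mk' (fun v => fderiv ℝ f x (v 0)) (fun v i a b => ?_)
      (fun v i c a => ?_), rfl⟩, fun v => ?_⟩
    · rw [show i = 0 from Fin.ext (by omega)]; simp
    · rw [show i = 0 from Fin.ext (by omega)]; simp
    · exact (hx.map.fderiv_right (m := ∞) (by simp)).clm_apply contDiffAt_const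
  | succ k ih =>
    intro x h
    have hx := h.self_of_nhds
    have h' := h.eventually_nhds
    have hS : ∀ v, ContDiffAt ℝ ∞ (fun y => covDeriv G G' f k y v) x := (ih h).2
    have hd : ∀ v, DifferentiableAt ℝ (fun y => covDeriv G G' f k y v) x :=
      fun v => (hS v).differentiableAt (by simp)
    -- Additivity is needed on a neighbourhood, since `fderiv` is about to be applied to it.
    have hadd : ∀ v i a b, (fun y => covDeriv G G' f k y (Function.update v i (a + b))) =ᶠ[𝓝 x]
        fun y => covDeriv G G' f k y (Function.update v i a) +
          covDeriv G G' f k y (Function.update v i b) := fun v i a b => by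
      filter_upwards [h'] with y hy
      obtain ⟨F, hF⟩ := (ih hy).1
      rw [← hF, F.map_update_add]
    have hsmul : ∀ v i (c : ℝ) a, (fun y => covDeriv G G' f k y (Function.update v i (c • a)))
        =ᶠ[𝓝 x] fun y => c • covDeriv G G' f k y (Function.update v i a) := fun v i c a => by
      filter_upwards [h'] with y hy
      obtain ⟨F, hF⟩ := (ih hy).1
      rw [← hF, F.map_update_smul]
    have hadd₀ : ∀ v i a b, covDeriv G G' f k x (Function.update v i (a + b)) =
        covDeriv G G' f k x (Function.update v i a) + covDeriv G G' f k x (Function.update v i b) :=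
      fun v i a b => (hadd v i a b).self_of_nhds
    have hsmul₀ : ∀ v i (c : ℝ) a, covDeriv G G' f k x (Function.update v i (c • a)) =
        c • covDeriv G G' f k x (Function.update v i a) :=
      fun v i c a => (hsmul v i c a).self_of_nhds
    refine ⟨⟨MultilinearMap.mk' (covDeriv G G' f (k + 1) x) (fun v i a b => ?_)
      (fun v i c a => ?_), rfl⟩, fun v => ?_⟩
    · simp only [covDeriv, ← christoffelCLM_apply]
      refine Fin.cases ?_ (fun i => ?_) i
      · simp only [Fin.tail_update_zero, Function.update_self, map_add,
          add_apply]
        have : ∀ j, covDeriv G G' f k x (Function.update (Fin.tail v) j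
            (christoffelCLM G x a (Fin.tail v j) + christoffelCLM G x b (Fin.tail v j))) =
          covDeriv G G' f k x (Function.update (Fin.tail v) j
            (christoffelCLM G x a (Fin.tail v j))) + covDeriv G G' f k x
              (Function.update (Fin.tail v) j (christoffelCLM G x b (Fin.tail v j))) :=
          fun j => hadd₀ _ j _ _
        simp only [this, Finset.sum_add_distrib]
        abel
      · have h0 : ∀ w, Function.update v i.succ w 0 = v 0 := fun w =>
          Function.update_of_ne (Fin.succ_ne_zero i).symm _ _
        simp only [Fin.tail_update_succ, h0]
        rw [(hadd (Fin.tail v) i a b).fderiv_eq, fderiv_fun_add (hd _) (hd _),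
          hadd₀ (Fin.tail v) i a b]
        have : ∀ j, covDeriv G G' f k x (Function.update (Function.update (Fin.tail v) i (a + b)) j
            (christoffelCLM G x (v 0) (Function.update (Fin.tail v) i (a + b) j))) =
            covDeriv G G' f k x (Function.update (Function.update (Fin.tail v) i a) j
              (christoffelCLM G x (v 0) (Function.update (Fin.tail v) i a j))) +
            covDeriv G G' f k x (Function.update (Function.update (Fin.tail v) i b) j
              (christoffelCLM G x (v 0) (Function.update (Fin.tail v) i b j))) := fun j => by
          by_cases hij : j = i
          · subst hij
            simp only [Function.update_self, Function.update_idem, map_add]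
            exact hadd₀ _ j _ _
          · simp only [Function.update_of_ne hij, Function.update_comm (Ne.symm hij)]
            exact hadd₀ _ i _ _
        simp only [this, Finset.sum_add_distrib, map_add, add_apply]
        abel
    · simp only [covDeriv, ← christoffelCLM_apply]
      refine Fin.cases ?_ (fun i => ?_) i
      · simp only [Fin.tail_update_zero, Function.update_self, map_smul,
          smul_apply]
        have : ∀ j, covDeriv G G' f k x (Function.update (Fin.tail v) j
            (c • christoffelCLM G x a (Fin.tail v j))) =
          c • covDeriv G G' f k x (Function.update (Fin.tail v) j
            (christoffelCLM G x a (Fin.tail v j))) :=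
          fun j => hsmul₀ _ j _ _
        simp only [this, ← Finset.smul_sum, smul_add, smul_sub]
      · have h0 : ∀ w, Function.update v i.succ w 0 = v 0 := fun w =>
          Function.update_of_ne (Fin.succ_ne_zero i).symm _ _
        simp only [Fin.tail_update_succ, h0]
        rw [(hsmul (Fin.tail v) i c a).fderiv_eq, fderiv_fun_const_smul (hd _),
          hsmul₀ (Fin.tail v) i c a]
        have : ∀ j, covDeriv G G' f k x (Function.update (Function.update (Fin.tail v) i (c • a)) j
            (christoffelCLM G x (v 0) (Function.update (Fin.tail v) i (c • a) j))) =
            c • covDeriv G G' f k x (Function.update (Function.update (Fin.tail v) i a) j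
              (christoffelCLM G x (v 0) (Function.update (Fin.tail v) i a j))) := fun j => by
          by_cases hij : j = i
          · subst hij
            simp only [Function.update_self, Function.update_idem, map_smul]
            exact hsmul₀ _ j _ _
          · simp only [Function.update_of_ne hij, Function.update_comm (Ne.symm hij)]
            exact hsmul₀ _ i _ _
        simp only [this, ← Finset.smul_sum, map_smul, smul_apply, smul_add,
          smul_sub]
    · simp only [covDeriv, ← christoffelCLM_apply]
      have hdf : ContDiffAt ℝ ∞ (fun y => fderiv ℝ f y (v 0)) x :=
        (hx.map.fderiv_right (m := ∞) (by simp)).clm_apply contDiffAt_const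
      refine ContDiffAt.sub (ContDiffAt.add ?_ ?_) (ContDiffAt.sum fun i _ => ?_)
      · exact ((hS (Fin.tail v)).fderiv_right (m := ∞) (by simp)).clm_apply contDiffAt_const
      · exact ((ContDiffAt.comp x (contDiffAt_christoffelCLM hx.target hx.target_inv)
          hx.map).clm_apply hdf).clm_apply (hS _)
      · have : (fun y => covDeriv G G' f k y (Function.update (Fin.tail v) i
            (christoffelCLM G y (v 0) (Fin.tail v i)))) =ᶠ[𝓝 x] fun y =>
            ∑ a, (Module.finBasis ℝ V).repr (christoffelCLM G y (v 0) (Fin.tail v i)) a •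
              covDeriv G G' f k y (Function.update (Fin.tail v) i (Module.finBasis ℝ V a)) := by
          filter_upwards [h'] with y hy
          obtain ⟨F, hF⟩ := (ih hy).1
          rw [← hF, F.map_update_basis]
        refine ContDiffAt.congr_of_eventuallyEq (ContDiffAt.sum fun a _ => ?_) this
        refine ContDiffAt.smul ?_ (hS _)
        exact ContDiffAt.comp x (LinearMap.toContinuousLinearMap
          ((Module.finBasis ℝ V).coord a)).contDiff.contDiffAt
          (((contDiffAt_christoffelCLM hx.source hx.source_inv).clm_apply
            contDiffAt_const).clm_apply contDiffAt_const)

/-- The recursion defining `covDeriv`, solved for the ordinary derivative. The first derivative of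
`f` is written as `covDeriv` at level `0`, so that bounds on `covDeriv` apply to every term. -/
theorem fderiv_covDeriv_apply {x : V} (h : ∀ᶠ y in 𝓝 x, RegularAt G G' f y) (k : ℕ)
    (v : Fin (k + 1) → V) (u : V) :
    fderiv ℝ (fun y => covDeriv G G' f k y v) x u =
      covDeriv G G' f (k + 1) x (Fin.cons u v)
        - christoffelCLM G' (f x) (covDeriv G G' f 0 x (fun _ => u)) (covDeriv G G' f k x v)
        + ∑ i, ∑ a, (Module.finBasis ℝ V).repr (christoffelCLM G x u (v i)) a •
            covDeriv G G' f k x (Function.update v i (Module.finBasis ℝ V a)) := by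
  obtain ⟨F, hF⟩ := (covDeriv_multilinear_and_contDiffAt k h).1
  simp only [← hF, ← MultilinearMap.map_update_basis]
  simp only [hF]
  simp only [covDeriv, christoffelCLM_apply, Fin.cons_zero, Fin.tail_cons]
  abel

/-- Bounds on the covariant derivatives imply bounds on the derivatives. -/
theorem locBdd_of_covDeriv_bounded {ι : Type*} {l : Filter ι} {G' : ι → W → W →L[ℝ] W →L[ℝ] ℝ}
    {f : ι → V → W} {x₀ : V} {z₀ : W} {B₀ : W →L[ℝ] W →L[ℝ] ℝ}
    (hG : ∀ᶠ y in 𝓝 x₀, ContDiffAt ℝ ∞ G y) (hGi : (G x₀).IsInvertible)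
    (hG' : ∀ j, LocBdd l G' z₀ j)
    (hG't : Tendsto (fun p : ι × W => G' p.1 p.2) (l ×ˢ 𝓝 z₀) (𝓝 B₀)) (hB₀ : B₀.IsInvertible)
    (hf : ∀ᶠ p in l ×ˢ 𝓝 x₀, ContDiffAt ℝ ∞ (f p.1) p.2)
    (hft : Tendsto (fun p : ι × V => f p.1 p.2) (l ×ˢ 𝓝 x₀) (𝓝 z₀))
    (hb : ∀ k v, ∃ C, ∀ᶠ p in l ×ˢ 𝓝 x₀, ‖covDeriv G (G' p.1) (f p.1) k p.2 v‖ ≤ C) (j : ℕ) :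
    LocBdd l f x₀ j := by
  have hft' : Tendsto (fun p : ι × V => (p.1, f p.1 p.2)) (l ×ˢ 𝓝 x₀) (l ×ˢ 𝓝 z₀) :=
    tendsto_fst.prodMk hft
  have hGc : ContinuousAt G x₀ := hG.self_of_nhds.continuousAt
  have hreg : ∀ᶠ p in l ×ˢ 𝓝 x₀, ∀ᶠ y in 𝓝 p.2, RegularAt G (G' p.1) (f p.1) y := by
    refine eventually_prod_nhds_eventually (P := fun n y => RegularAt G (G' n) (f n) y) ?_
    filter_upwards [hf, hG.prod_inr l, (hGc.eventually hGi.eventually_nhds).prod_inr l,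
      hft'.eventually (hG' 0).1, (hG't.comp hft').eventually hB₀.eventually_nhds]
      with p h1 h2 h3 h4 h5 using ⟨h1, h2, h3, h4, h5⟩
  have hf0 : LocBdd l f x₀ 0 := by
    refine ⟨hf, fun i hi => ⟨‖z₀‖ + 1, ?_⟩⟩
    obtain rfl : i = 0 := by omega
    filter_upwards [hft.norm.eventually_lt_const (lt_add_one _)] with p hp
    rw [norm_iteratedFDeriv_zero]
    exact hp.le
  have hΓ : ∀ j, LocBdd l (fun _ => christoffelCLM G) x₀ j :=
    LocBdd.christoffelCLM (fun j => LocBdd.of_fixed hG) (hGc.tendsto.comp tendsto_snd) hGi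
  have hS : ∀ j k v, LocBdd l (fun n y => covDeriv G (G' n) (f n) k y v) x₀ j := by
    intro j
    -- All levels `k` are treated at once, because one more derivative at level `k` costs level `k +
    -- 1`.
    induction j with
    | zero =>
      refine fun k v => ⟨hreg.mono fun p hp => (covDeriv_multilinear_and_contDiffAt k hp).2 v,
        fun i hi => ?_⟩
      obtain rfl : i = 0 := by omega
      simpa only [norm_iteratedFDeriv_zero] using hb k v
    | succ j ih =>
      refine fun k v => LocBdd.of_fderiv_apply ((ih k v).mono (Nat.zero_le j)) fun u => ?_
      -- The Christoffel symbols of `G' n` are evaluated along `f n`, so `f` must already be bounded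
      -- to order `j`; level `0` of the induction hypothesis provides this.
      have hfj : LocBdd l f x₀ j := (hf0.of_fderiv_apply fun u => ih 0 fun _ => u).mono (by omega)
      have hΓ' := hfj.comp (LocBdd.christoffelCLM hG' hG't hB₀ j) hft
      have hT := LocBdd.bilinear (ContinuousLinearMap.id ℝ (W →L[ℝ] W))
        (LocBdd.bilinear (ContinuousLinearMap.id ℝ (W →L[ℝ] W →L[ℝ] W)) hΓ' (ih 0 fun _ => u))
        (ih k v)
      have hsum := LocBdd.sum Finset.univ fun i _ => LocBdd.sum Finset.univ fun a _ =>
        LocBdd.bilinear (ContinuousLinearMap.lsmul ℝ ℝ)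
          (LocBdd.clm (LinearMap.toContinuousLinearMap ((Module.finBasis ℝ V).coord a))
            (LocBdd.bilinear (ContinuousLinearMap.id ℝ (V →L[ℝ] V)) (LocBdd.bilinear
              (ContinuousLinearMap.id ℝ (V →L[ℝ] V →L[ℝ] V)) (hΓ j) (LocBdd.const u))
              (LocBdd.const (v i))))
          (ih k (Function.update v i (Module.finBasis ℝ V a)))
      refine (((ih (k + 1) (Fin.cons u v)).sub hT).add hsum).congr (hreg.mono fun p hp => ?_)
      rw [fderiv_covDeriv_apply hp]
      rfl
  exact (hf0.of_fderiv_apply fun u => hS j 0 fun _ => u).mono (Nat.le_succ j)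

end CovariantBounds

/-! ### Riemannian metrics in coordinates -/

section MetricInChart

set_option maxSynthPendingDepth 3

/-- A positive definite form on a finite-dimensional space is nondegenerate. -/
theorem isInvertible_of_pos {E : Type*} [NormedAddCommGroup E] [NormedSpace ℝ E]
    [FiniteDimensional ℝ E] {B : E →L[ℝ] E →L[ℝ] ℝ} (hB : ∀ u, u ≠ 0 → 0 < B u u) :
    B.IsInvertible := by
  have hinj : Function.Injective B := by
    refine (injective_iff_map_eq_zero B).2 fun u hu => ?_
    by_contra h
    have := hB u h
    simp [hu] at this
  have hfr : Module.finrank ℝ E = Module.finrank ℝ (E →L[ℝ] ℝ) := by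
    rw [(LinearMap.toContinuousLinearMap (𝕜 := ℝ) (E := E) (F' := ℝ)).symm.finrank_eq]
    exact (Subspace.dual_finrank_eq (K := ℝ) (V := E)).symm
  exact ⟨(LinearEquiv.ofInjectiveOfFinrankEq (B : E →ₗ[ℝ] E →L[ℝ] ℝ) hinj
    hfr).toContinuousLinearEquiv, by ext; rfl⟩

/-- Forms close to a positive definite one are uniformly positive definite. -/
theorem exists_pos_eventually_le {E : Type*} [NormedAddCommGroup E] [NormedSpace ℝ E]
    [FiniteDimensional ℝ E] {B : E →L[ℝ] E →L[ℝ] ℝ} (hB : ∀ u, u ≠ 0 → 0 < B u u) :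
    ∃ c, 0 < c ∧ ∀ᶠ B' in 𝓝 B, ∀ u, c * ‖u‖ ^ 2 ≤ B' u u := by
  obtain ⟨c, hc, H⟩ : ∃ c, 0 < c ∧ ∀ u : E, c * ‖u‖ ^ 2 ≤ B u u := by
    -- An empty unit sphere means that `E` is trivial. Otherwise the minimum on the compact sphere
    -- is positive and extends by homogeneity.
    rcases (Metric.sphere (0 : E) 1).eq_empty_or_nonempty with h | h
    · refine ⟨1, one_pos, fun u => ?_⟩
      have hu : u = 0 := by
        by_contra hu
        have : (‖u‖⁻¹ • u) ∈ Metric.sphere (0 : E) 1 := by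
          simp [norm_smul, norm_ne_zero_iff.2 hu]
        rw [h] at this
        exact this
      simp [hu]
    · obtain ⟨u₀, hu₀, hmin⟩ := (isCompact_sphere (0 : E) 1).exists_isMinOn h
        (f := fun u => B u u) (B.continuous.clm_apply continuous_id).continuousOn
      refine ⟨B u₀ u₀, hB _ (fun h0 => by simp [h0] at hu₀), fun u => ?_⟩
      by_cases hu : u = 0
      · simp [hu]
      have hn : ‖u‖ ≠ 0 := norm_ne_zero_iff.2 hu
      have h1 : (‖u‖⁻¹ • u) ∈ Metric.sphere (0 : E) 1 := by simp [norm_smul, hn]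
      have h2 : B u₀ u₀ ≤ ‖u‖⁻¹ * (‖u‖⁻¹ * B u u) := by simpa using hmin h1
      calc B u₀ u₀ * ‖u‖ ^ 2 ≤ ‖u‖⁻¹ * (‖u‖⁻¹ * B u u) * ‖u‖ ^ 2 := by gcongr
        _ = B u u := by field_simp
  -- The other half of `c` absorbs the perturbation `B' - B`.
  refine ⟨c / 2, half_pos hc, ?_⟩
  filter_upwards [Metric.ball_mem_nhds B (half_pos hc)] with B' hB' u
  have hB' : ‖B' - B‖ < c / 2 := by simpa [Metric.mem_ball, dist_eq_norm] using hB'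
  have h1 : |(B' - B) u u| ≤ c / 2 * ‖u‖ ^ 2 := by
    refine ((B' - B).le_opNorm₂ u u).trans ?_
    rw [mul_assoc, ← sq]
    gcongr
  have h2 : (B' - B) u u = B' u u - B u u := by simp
  rw [h2] at h1
  linarith [H u, (abs_le.1 h1).1]

variable {m : ℕ} {M : Type*} [TopologicalSpace M] [ChartedSpace (EuclideanSpace ℝ (Fin m)) M]
  [IsManifold (𝓡 m) ∞ M]
  (g : Bundle.ContMDiffRiemannianMetric (𝓡 m) ∞ (EuclideanSpace ℝ (Fin m))
      (fun x : M => TangentSpace (𝓡 m) x))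
  {e : OpenPartialHomeomorph M (EuclideanSpace ℝ (Fin m))}

-- The derivative of `e.symm` is injective, being a right inverse of that of `e`.
include g in
theorem metricInChart_pos (he : e ∈ atlas (EuclideanSpace ℝ (Fin m)) M)
    {y : EuclideanSpace ℝ (Fin m)} (hy : y ∈ e.target) (u : EuclideanSpace ℝ (Fin m)) (hu : u ≠ 0) :
    0 < metricInChart g e y u u := by
  have hd : e.MDifferentiable (𝓡 m) (𝓡 m) :=
    have : IsManifold (𝓡 m) 1 M := IsManifold.of_le (n := ∞) (by simp)
    mdifferentiable_of_mem_atlas he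
  refine g.pos (e.symm y) _ fun h0 => hu ?_
  have h1 := hd.comp_symm_deriv hy
  have h2 := congrArg (fun L => L u) h1
  change mfderiv (𝓡 m) (𝓡 m) e (e.symm y) (mfderiv (𝓡 m) (𝓡 m) e.symm y u) = u at h2
  rw [← h2]
  erw [h0]
  exact map_zero _

/-- Smoothness is tested on constant vectors `u`, `v`: their images under the derivative of `e.symm`
are smooth sections along `e.symm`, which the smooth bundle metric contracts. -/
theorem contDiffOn_metricInChart (he : e ∈ atlas (EuclideanSpace ℝ (Fin m)) M) :
    ContDiffOn ℝ ∞ (metricInChart g e) e.target := by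
  have : IsManifold (𝓡 m) 1 M := IsManifold.of_le (n := ∞) (by simp)
  have hs : ContMDiffOn (𝓡 m) (𝓡 m) ∞ e.symm e.target :=
    contMDiffOn_symm_of_mem_maximalAtlas (IsManifold.subset_maximalAtlas he)
  have hsec : ∀ u : EuclideanSpace ℝ (Fin m), ContMDiffOn (𝓡 m) ((𝓡 m).prod (𝓡 m)) ∞
      (fun y => Bundle.TotalSpace.mk' (EuclideanSpace ℝ (Fin m))
        (E := fun x : M => TangentSpace (𝓡 m) x) (e.symm y)
        (mfderiv (𝓡 m) (𝓡 m) e.symm y u)) e.target := fun u => by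
    have h1 := hs.contMDiffOn_tangentMapWithin (m := ∞) (by simp) e.open_target.uniqueMDiffOn
    have h2 : ContMDiffOn (𝓡 m) (𝓡 m).tangent ∞ (fun y : EuclideanSpace ℝ (Fin m) =>
        (⟨y, u⟩ : TangentBundle (𝓡 m) (EuclideanSpace ℝ (Fin m)))) e.target :=
      contMDiffOn_vectorSpace_iff_contDiffOn.2 contDiffOn_const
    refine (h1.comp h2 (fun y hy => hy)).congr fun y hy => ?_
    simp only [Function.comp_apply, tangentMapWithin, mfderivWithin_of_isOpen e.open_target hy]
  refine contDiffOn_clm_apply.2 fun u => contDiffOn_clm_apply.2 fun v y hy => ?_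
  have hB : ContMDiffWithinAt (𝓡 m) ((𝓡 m).prod 𝓘(ℝ)) ∞
      (fun y => Bundle.TotalSpace.mk' ℝ (E := Bundle.Trivial M ℝ) (e.symm y)
        (g.inner (e.symm y) (mfderiv (𝓡 m) (𝓡 m) e.symm y u) (mfderiv (𝓡 m) (𝓡 m) e.symm y v)))
      e.target y := by
    apply ContMDiffWithinAt.clm_bundle_apply₂ (F₁ := EuclideanSpace ℝ (Fin m))
      (F₂ := EuclideanSpace ℝ (Fin m))
    · exact ContMDiffAt.comp_contMDiffWithinAt y g.contMDiff.contMDiffAt (hs y hy)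
    · exact hsec u y hy
    · exact hsec v y hy
  simp only [Bundle.contMDiffWithinAt_totalSpace] at hB
  exact hB.2.contDiffWithinAt

end MetricInChart

/-! ### Laminated charts and plaques -/

section Plaques

set_option maxSynthPendingDepth 3

theorem isOpen_openCube (d : ℕ) : IsOpen (openCube d) := by
  have : openCube d = ⋂ a, (fun z : EuclideanSpace ℝ (Fin d) => z a) ⁻¹' Ioo (-1 : ℝ) 1 := by
    ext z; simp [openCube]
  rw [this]
  exact isOpen_iInter_of_finite fun a => isOpen_Ioo.preimage (by fun_prop)

namespace TransverselySmoothOn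

variable {V T V' : Type*} [NormedAddCommGroup V] [NormedSpace ℝ V] [TopologicalSpace T]
  [NormedAddCommGroup V'] [NormedSpace ℝ V'] {f : V × T → V'} {O : Set V}

theorem contDiffAt (hf : TransverselySmoothOn f (O ×ˢ univ)) (hO : IsOpen O) (t : T) {z : V}
    (hz : z ∈ O) : ContDiffAt ℝ ∞ (fun z => f (z, t)) z :=
  (hf.smooth t).contDiffAt (by simpa using! hO.mem_nhds hz)

/-- Joint continuity: uniformity in `z` on a closed ball handles the change of `t`, and continuity
of the derivative at `t₀` the change of `z`. -/
theorem tendsto_iteratedFDeriv [ProperSpace V] (hf : TransverselySmoothOn f (O ×ˢ univ))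
    (hO : IsOpen O) {z₀ : V} (hz₀ : z₀ ∈ O) (t₀ : T) (k : ℕ) :
    Tendsto (fun p : T × V => iteratedFDeriv ℝ k (fun z => f (z, p.1)) p.2) (𝓝 t₀ ×ˢ 𝓝 z₀)
      (𝓝 (iteratedFDeriv ℝ k (fun z => f (z, t₀)) z₀)) := by
  obtain ⟨r, hr, hrO⟩ := Metric.nhds_basis_closedBall.mem_iff.1 (hO.mem_nhds hz₀)
  have hu := hf.continuous k t₀ _ (isCompact_closedBall z₀ r) fun z hz => ⟨hrO hz, mem_univ _⟩
  have hc : ContinuousAt (iteratedFDeriv ℝ k (fun z => f (z, t₀))) z₀ :=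
    (hf.contDiffAt hO t₀ hz₀).continuousAt_iteratedFDeriv (by exact_mod_cast le_top)
  rw [Metric.tendsto_nhds]
  intro ε hε
  filter_upwards [((Metric.tendstoUniformlyOn_iff.1 hu _ (half_pos hε)).prod_inl (𝓝 z₀)),
    ((Metric.tendsto_nhds.1 hc _ (half_pos hε)).and
      (Metric.closedBall_mem_nhds z₀ hr)).prod_inr (𝓝 t₀)] with p h1 h2
  have h3 := h1 p.2 h2.2
  rw [dist_comm] at h3
  have := dist_triangle (iteratedFDeriv ℝ k (fun z => f (z, p.1)) p.2)
    (iteratedFDeriv ℝ k (fun z => f (z, t₀)) p.2) (iteratedFDeriv ℝ k (fun z => f (z, t₀)) z₀)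
  linarith [h2.1]

theorem tendsto [ProperSpace V] (hf : TransverselySmoothOn f (O ×ˢ univ))
    (hO : IsOpen O) {z₀ : V} (hz₀ : z₀ ∈ O) (t₀ : T) :
    Tendsto (fun p : T × V => f (p.2, p.1)) (𝓝 t₀ ×ˢ 𝓝 z₀) (𝓝 (f (z₀, t₀))) := by
  have h := hf.tendsto_iteratedFDeriv hO hz₀ t₀ 0
  simp only [iteratedFDeriv_zero_eq_comp, Function.comp_apply] at h
  have h2 := ((continuousMultilinearCurryFin0 ℝ V V').continuous.tendsto _).comp h
  simpa using! h2

theorem locBdd [ProperSpace V] (hf : TransverselySmoothOn f (O ×ˢ univ))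
    (hO : IsOpen O) {z₀ : V} (hz₀ : z₀ ∈ O) {t₀ : T} {ι : Type*} {l : Filter ι} {t : ι → T}
    (ht : Tendsto t l (𝓝 t₀)) (j : ℕ) : LocBdd l (fun n z => f (z, t n)) z₀ j := by
  refine ⟨?_, fun i _ =>
    ⟨‖iteratedFDeriv ℝ i (fun z => f (z, t₀)) z₀‖ + 1, ?_⟩⟩
  · filter_upwards [Eventually.prod_inr (hO.mem_nhds hz₀) l] with p hp
      using hf.contDiffAt hO (t p.1) hp
  · have h1 := (hf.tendsto_iteratedFDeriv hO hz₀ t₀ i).comp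
      ((ht.comp tendsto_fst).prodMk (tendsto_snd (f := l) (g := 𝓝 z₀)))
    filter_upwards [h1.norm.eventually_lt_const (lt_add_one _)] with p hp using hp.le

end TransverselySmoothOn

variable {m d : ℕ} {X : Type*} [TopologicalSpace X] {𝓛 : Lamination d X}

namespace Lamination

theorem tang_mem_openCube {i : 𝓛.ι} {q : X} (hq : q ∈ (𝓛.chart i).source) :
    𝓛.tang i q ∈ openCube d := by
  have := (𝓛.chart i).map_source hq
  rw [𝓛.target_eq] at this
  exact this.1

theorem symm_tang_trans {i : 𝓛.ι} {q : X} (hq : q ∈ (𝓛.chart i).source) :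
    (𝓛.chart i).symm (𝓛.tang i q, 𝓛.trans i q) = q :=
  (𝓛.chart i).left_inv hq

theorem mem_target {i : 𝓛.ι} {z : EuclideanSpace ℝ (Fin d)} (hz : z ∈ openCube d) (t : 𝓛.T i) :
    (z, t) ∈ (𝓛.chart i).target := by
  rw [𝓛.target_eq]
  exact ⟨hz, mem_univ _⟩

theorem continuousAt_tang {i : 𝓛.ι} {q : X} (hq : q ∈ (𝓛.chart i).source) :
    ContinuousAt (𝓛.tang i) q :=
  continuousAt_fst.comp ((𝓛.chart i).continuousAt hq)

theorem continuousAt_trans {i : 𝓛.ι} {q : X} (hq : q ∈ (𝓛.chart i).source) :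
    ContinuousAt (𝓛.trans i) q :=
  continuousAt_snd.comp ((𝓛.chart i).continuousAt hq)

/-- A compact piece of a plaque is closed. -/
theorem isClosed_plaque_piece [T2Space X] (i : 𝓛.ι) {Q : Set (EuclideanSpace ℝ (Fin d))}
    (hQ : IsCompact Q) (hQc : Q ⊆ openCube d) (t : 𝓛.T i) :
    IsClosed {q | q ∈ (𝓛.chart i).source ∧ 𝓛.trans i q = t ∧ 𝓛.tang i q ∈ Q} := by
  have : {q | q ∈ (𝓛.chart i).source ∧ 𝓛.trans i q = t ∧ 𝓛.tang i q ∈ Q} =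
      (fun z => (𝓛.chart i).symm (z, t)) '' Q := by
    ext q
    constructor
    · rintro ⟨h1, rfl, h3⟩
      exact ⟨_, h3, symm_tang_trans h1⟩
    · rintro ⟨z, hz, rfl⟩
      have h := mem_target (hQc hz) t
      refine ⟨(𝓛.chart i).map_target h, ?_, ?_⟩
      · simp only [trans, (𝓛.chart i).right_inv h]
      · simpa only [tang, (𝓛.chart i).right_inv h] using hz
  rw [this]
  refine (hQ.image_of_continuousOn fun z hz => ?_).isClosed
  exact (((𝓛.chart i).continuousAt_symm (mem_target (hQc hz) t)).comp
    (f := fun z => (z, t)) (by fun_prop)).continuousWithinAt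

end Lamination

/-- A map into a leaf with small derivative stays in the plaque in which it starts. -/
theorem mem_plaque_of_norm_fderiv_le [T2Space X] {E : Type*} [NormedAddCommGroup E]
    [NormedSpace ℝ E] {i : 𝓛.ι} {F : E → X} {y₀ : E} {s r A : ℝ}
    (hF : ContinuousOn F (Metric.ball y₀ s)) (h₀ : F y₀ ∈ (𝓛.chart i).source) (hA : 0 ≤ A)
    (hAs : A * s < r) (hr : Metric.closedBall (𝓛.tang i (F y₀)) r ⊆ openCube d)
    (hloc : ∀ y ∈ Metric.ball y₀ s, F y ∈ (𝓛.chart i).source →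
      (∀ᶠ y' in 𝓝 y, F y' ∈ (𝓛.chart i).source ∧ 𝓛.trans i (F y') = 𝓛.trans i (F y)) ∧
        DifferentiableAt ℝ (fun y' => 𝓛.tang i (F y')) y)
    (hbd : ∀ y ∈ Metric.ball y₀ s, F y ∈ (𝓛.chart i).source →
      𝓛.trans i (F y) = 𝓛.trans i (F y₀) →
      𝓛.tang i (F y) ∈ Metric.closedBall (𝓛.tang i (F y₀)) r →
      ‖fderiv ℝ (fun y' => 𝓛.tang i (F y')) y‖ ≤ A)
    {y : E} (hy : y ∈ Metric.ball y₀ s) :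
    F y ∈ (𝓛.chart i).source ∧ 𝓛.trans i (F y) = 𝓛.trans i (F y₀) ∧
      ‖𝓛.tang i (F y) - 𝓛.tang i (F y₀)‖ ≤ A * ‖y - y₀‖ := by
  set z₁ := 𝓛.tang i (F y₀) with hz₁
  set γ : ℝ → E := fun τ => y₀ + τ • (y - y₀) with hγ
  have hγc : Continuous γ := by fun_prop
  have hyn : ‖y - y₀‖ < s := by simpa [dist_eq_norm] using hy
  have hs : 0 < s := (norm_nonneg _).trans_lt hyn
  have hγB : ∀ τ ∈ Icc (0:ℝ) 1, γ τ ∈ Metric.ball y₀ s := fun τ hτ => by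
    have : ‖γ τ - y₀‖ = τ * ‖y - y₀‖ := by simp [hγ, norm_smul, abs_of_nonneg hτ.1]
    rw [Metric.mem_ball, dist_eq_norm, this]
    nlinarith [hτ.2, norm_nonneg (y - y₀)]
  set c := A * ‖y - y₀‖ with hc
  have hc0 : 0 ≤ c := by positivity
  have hcr : c < r := (mul_le_mul_of_nonneg_left hyn.le hA).trans_lt hAs
  -- Continuity method along the segment from `y₀` to `y`: the good times form a closed set
  -- containing `0` which can always be prolonged.
  set S : Set ℝ := {τ | F (γ τ) ∈ (𝓛.chart i).source ∧ 𝓛.trans i (F (γ τ)) = 𝓛.trans i (F y₀) ∧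
    ‖𝓛.tang i (F (γ τ)) - z₁‖ ≤ c * τ} with hS
  have hFγ : ∀ τ ∈ Icc (0:ℝ) 1, ContinuousAt (fun τ => F (γ τ)) τ := fun τ hτ =>
    (hF.continuousAt (Metric.isOpen_ball.mem_nhds (hγB τ hτ))).comp hγc.continuousAt
  have hclosed : IsClosed (S ∩ Icc 0 1) := by
    refine isClosed_of_closure_subset fun τ hτ => ?_
    have hτI : τ ∈ Icc (0:ℝ) 1 := isClosed_Icc.closure_subset_iff.2 inter_subset_right hτ
    have hne := mem_closure_iff_nhdsWithin_neBot.1 hτ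
    -- The chart domain is only open; the limit stays in it because the piece of plaque over the
    -- closed ball of radius `r` is closed in `X`.
    have hP := Lamination.isClosed_plaque_piece (𝓛 := 𝓛) i (isCompact_closedBall z₁ r) hr
      (𝓛.trans i (F y₀))
    have hlim : Tendsto (fun τ => F (γ τ)) (𝓝[S ∩ Icc 0 1] τ) (𝓝 (F (γ τ))) :=
      (hFγ τ hτI).mono_left nhdsWithin_le_nhds
    have hev : ∀ᶠ τ' in 𝓝[S ∩ Icc 0 1] τ, τ' ∈ S ∩ Icc 0 1 := self_mem_nhdsWithin
    have hmem := hP.mem_of_tendsto hlim (hev.mono fun τ' hτ' => ⟨hτ'.1.1, hτ'.1.2.1, by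
      rw [Metric.mem_closedBall, dist_eq_norm]
      refine hτ'.1.2.2.trans ((mul_le_of_le_one_right hc0 hτ'.2.2).trans hcr.le)⟩)
    refine ⟨⟨hmem.1, hmem.2.1, ?_⟩, hτI⟩
    have h1 : Tendsto (fun τ' => ‖𝓛.tang i (F (γ τ')) - z₁‖) (𝓝[S ∩ Icc 0 1] τ)
        (𝓝 ‖𝓛.tang i (F (γ τ)) - z₁‖) :=
      (((Lamination.continuousAt_tang hmem.1).tendsto.comp hlim).sub_const _).norm
    have h2 : Tendsto (fun τ' => c * τ') (𝓝[S ∩ Icc 0 1] τ) (𝓝 (c * τ)) :=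
      (tendsto_id.mono_left nhdsWithin_le_nhds).const_mul c
    exact le_of_tendsto_of_tendsto h1 h2 (hev.mono fun τ' hτ' => hτ'.1.2.2)
  have h0S : (0:ℝ) ∈ S := by
    have : γ 0 = y₀ := by simp [hγ]
    simp [hS, this, h₀, hz₁]
  -- Since `c < r`, a good time leaves room: the derivative bound persists on a small ball, and the
  -- mean value inequality prolongs the estimate.
  have hsub := hclosed.Icc_subset_of_forall_exists_gt h0S fun τ hτ b hb => by
    obtain ⟨⟨hτ1, hτ2, hτ3⟩, hτI⟩ := hτ
    have hτI' : τ ∈ Icc (0:ℝ) 1 := ⟨hτI.1, hτI.2.le⟩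
    obtain ⟨hl1, hl2⟩ := hloc _ (hγB τ hτI') hτ1
    have hn : ‖𝓛.tang i (F (γ τ)) - z₁‖ < r :=
      hτ3.trans_lt ((mul_le_of_le_one_right hc0 hτI'.2).trans_lt hcr)
    have hl3 : ∀ᶠ y' in 𝓝 (γ τ), ‖𝓛.tang i (F y') - z₁‖ < r :=
      (hl2.continuousAt.sub continuousAt_const).norm.eventually_lt continuousAt_const hn
    obtain ⟨δ, hδ, hD⟩ := Metric.eventually_nhds_iff_ball.1
      (hl1.and (hl3.and (Metric.isOpen_ball.mem_nhds (hγB τ hτI'))))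
    have hmv : ∀ y' ∈ Metric.ball (γ τ) δ,
        ‖𝓛.tang i (F y') - 𝓛.tang i (F (γ τ))‖ ≤ A * ‖y' - γ τ‖ := fun y' hy' =>
      (convex_ball (γ τ) δ).norm_image_sub_le_of_norm_fderiv_le (𝕜 := ℝ)
        (f := fun y' => 𝓛.tang i (F y'))
        (fun w hw => (hloc w (hD w hw).2.2 (hD w hw).1.1).2)
        (fun w hw => hbd w (hD w hw).2.2 (hD w hw).1.1 ((hD w hw).1.2.trans hτ2) (by
          rw [Metric.mem_closedBall, dist_eq_norm]; exact (hD w hw).2.1.le))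
        (Metric.mem_ball_self hδ) hy'
    have hnear : ∀ᶠ τ' in 𝓝[>] τ, γ τ' ∈ Metric.ball (γ τ) δ :=
      (hγc.continuousAt.eventually (Metric.ball_mem_nhds _ hδ)).filter_mono nhdsWithin_le_nhds
    obtain ⟨τ', h1, h2⟩ := (hnear.and (Ioc_mem_nhdsGT hb)).exists
    refine ⟨τ', ⟨(hD _ h1).1.1, (hD _ h1).1.2.trans hτ2, ?_⟩, h2⟩
    have h3 : ‖γ τ' - γ τ‖ = (τ' - τ) * ‖y - y₀‖ := by
      have : γ τ' - γ τ = (τ' - τ) • (y - y₀) := by simp [hγ, sub_smul]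
      rw [this, norm_smul, Real.norm_of_nonneg (by linarith [h2.1])]
    calc ‖𝓛.tang i (F (γ τ')) - z₁‖
        = ‖(𝓛.tang i (F (γ τ')) - 𝓛.tang i (F (γ τ))) + (𝓛.tang i (F (γ τ)) - z₁)‖ := by
          rw [sub_add_sub_cancel]
      _ ≤ A * ((τ' - τ) * ‖y - y₀‖) + c * τ :=
          (norm_add_le _ _).trans (add_le_add (h3 ▸ hmv _ h1) hτ3)
      _ = c * τ' := by rw [hc]; ring
  have h1S := hsub (right_mem_Icc.2 zero_le_one)
  have hγ1 : γ 1 = y := by simp [hγ]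
  simpa only [hS, mem_ofPred_eq, hγ1, mul_one] using h1S

end Plaques

/-! ### Maps into leaves near a point of convergence -/

section LeafMaps

set_option maxSynthPendingDepth 3

variable {m d : ℕ} {X : Type*} [TopologicalSpace X] {𝓛 : Lamination d X}
  {M : Type*} [TopologicalSpace M] [ChartedSpace (EuclideanSpace ℝ (Fin m)) M]

/-- Near `x` the transverse coordinate is constant, so `Φ` is the inverse chart applied to a
continuous function. -/
theorem SmoothIntoLeaf.continuous {Φ : M → X} (hΦ : SmoothIntoLeaf (m := m) 𝓛 Φ) :
    Continuous Φ := by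
  refine continuous_iff_continuousAt.2 fun x => ?_
  obtain ⟨i, hi⟩ := 𝓛.cover (Φ x)
  obtain ⟨h1, h2⟩ := hΦ.2 x i hi
  have h3 : ContinuousAt (fun y => (𝓛.chart i).symm (𝓛.tang i (Φ y), 𝓛.trans i (Φ x))) x := by
    refine ContinuousAt.comp (g := (𝓛.chart i).symm)
      ((𝓛.chart i).continuousAt_symm ((𝓛.chart i).map_source hi)) ?_
    exact h2.continuousAt.prodMk continuousAt_const
  refine h3.congr (h1.mono fun y hy => ?_)
  simp only
  rw [← hy.2, Lamination.symm_tang_trans hy.1]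

variable [IsManifold (𝓡 m) ∞ M] {e : OpenPartialHomeomorph M (EuclideanSpace ℝ (Fin m))}

theorem SmoothIntoLeaf.contDiffAt_tang {Φ : M → X} (hΦ : SmoothIntoLeaf (m := m) 𝓛 Φ)
    (he : e ∈ atlas (EuclideanSpace ℝ (Fin m)) M) {y : EuclideanSpace ℝ (Fin m)}
    (hy : y ∈ e.target) {i : 𝓛.ι} (hi : Φ (e.symm y) ∈ (𝓛.chart i).source) :
    ContDiffAt ℝ ∞ (fun y' => 𝓛.tang i (Φ (e.symm y'))) y :=
  ((hΦ.2 _ i hi).2.comp y (contMDiffAt_symm_of_mem_maximalAtlas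
    (IsManifold.subset_maximalAtlas he) hy)).contDiffAt

variable (gM : Bundle.ContMDiffRiemannianMetric (𝓡 m) ∞ (EuclideanSpace ℝ (Fin m))
      (fun x : M => TangentSpace (𝓡 m) x)) (g : LaminatedMetric 𝓛)

/-- Replaces the Riemannian norms by fixed norms, using a lower bound for the leaf metric and an
upper bound for that of `M`. -/
theorem CovDerivLE.norm_covDeriv_le {gM : Bundle.ContMDiffRiemannianMetric (𝓡 m) ∞
      (EuclideanSpace ℝ (Fin m)) (fun x : M => TangentSpace (𝓡 m) x)} {g : LaminatedMetric 𝓛}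
    {Φ : M → X} {k : ℕ} {x : M} {A : ℝ}
    (h : CovDerivLE gM g Φ k x A) (hA : 0 ≤ A) (he : e ∈ atlas (EuclideanSpace ℝ (Fin m)) M)
    (hx : x ∈ e.source) {i : 𝓛.ι} (hi : Φ x ∈ (𝓛.chart i).source) {c C : ℝ} (hc : 0 < c)
    (hcoeff : ∀ u, c * ‖u‖ ^ 2 ≤ g.coeff i (𝓛.tang i (Φ x), 𝓛.trans i (Φ x)) u u)
    (hC : ‖metricInChart gM e (e x)‖ ≤ C) (v : Fin (k + 1) → EuclideanSpace ℝ (Fin m)) :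
    ‖covDeriv (metricInChart gM e) (fun z => g.coeff i (z, 𝓛.trans i (Φ x)))
      (fun y => 𝓛.tang i (Φ (e.symm y))) k (e x) v‖ ≤ (√c)⁻¹ * (A * ∏ a, (√C * ‖v a‖)) := by
  have h1 := h e he hx i hi v
  set w := covDeriv (metricInChart gM e) (fun z => g.coeff i (z, 𝓛.trans i (Φ x)))
      (fun y => 𝓛.tang i (Φ (e.symm y))) k (e x) v with hw
  simp only at h1
  have h2 : √c * ‖w‖ ≤ √(g.coeff i (𝓛.chart i (Φ x)) w w) := by
    rw [← Real.sqrt_sq (norm_nonneg w), ← Real.sqrt_mul hc.le]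
    exact Real.sqrt_le_sqrt (hcoeff w)
  have h3 : ∏ a, √(metricInChart gM e (e x) (v a) (v a)) ≤ ∏ a, (√C * ‖v a‖) := by
    refine Finset.prod_le_prod (fun a _ => Real.sqrt_nonneg _) fun a _ => ?_
    have h4 : metricInChart gM e (e x) (v a) (v a) ≤ C * ‖v a‖ ^ 2 := by
      refine (le_abs_self _).trans (((metricInChart gM e (e x)).le_opNorm₂ (v a) (v a)).trans ?_)
      rw [mul_assoc, ← sq]
      gcongr
    have hC0 : 0 ≤ C := (norm_nonneg _).trans hC
    calc _ ≤ √(C * ‖v a‖ ^ 2) := Real.sqrt_le_sqrt h4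
      _ = _ := by rw [Real.sqrt_mul hC0, Real.sqrt_sq (norm_nonneg _)]
  rw [le_inv_mul_iff₀ (Real.sqrt_pos.2 hc)]
  exact h2.trans (h1.trans (mul_le_mul_of_nonneg_left h3 hA))

variable {ι' : Type*} {l : Filter ι'} {Φ : ι' → M → X} {x₀ : M} {i : 𝓛.ι} {p : X}

include gM g in
/-- Maps into leaves with bounded derivatives which converge at a point stay near this point in
one plaque, and converge there uniformly. -/
theorem eventually_mem_plaque_and_tendsto [T2Space X]
    (hΦ : ∀ n, SmoothIntoLeaf (m := m) 𝓛 (Φ n))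
    (hb : ∃ A : ℝ, 0 < A ∧ ∀ᶠ x in 𝓝 x₀, ∀ n, CovDerivLE gM g (Φ n) 0 x A)
    (hp : p ∈ (𝓛.chart i).source) (hlim : Tendsto (fun n => Φ n x₀) l (𝓝 p)) :
    (∀ᶠ q in l ×ˢ 𝓝 x₀, Φ q.1 q.2 ∈ (𝓛.chart i).source ∧
      𝓛.trans i (Φ q.1 q.2) = 𝓛.trans i (Φ q.1 x₀)) ∧
    Tendsto (fun q : ι' × M => Φ q.1 q.2) (l ×ˢ 𝓝 x₀) (𝓝 p) := by
  set e := chartAt (EuclideanSpace ℝ (Fin m)) x₀ with he'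
  have he : e ∈ atlas (EuclideanSpace ℝ (Fin m)) M := chart_mem_atlas _ _
  have hx₀ : x₀ ∈ e.source := mem_chart_source _ _
  set z₀ := 𝓛.tang i p with hz₀
  set t₀ := 𝓛.trans i p with ht₀
  have hz₀m : z₀ ∈ openCube d := Lamination.tang_mem_openCube hp
  have ht : Tendsto (fun n => 𝓛.trans i (Φ n x₀)) l (𝓝 t₀) :=
    (Lamination.continuousAt_trans hp).tendsto.comp hlim
  have hz : Tendsto (fun n => 𝓛.tang i (Φ n x₀)) l (𝓝 z₀) :=
    (Lamination.continuousAt_tang hp).tendsto.comp hlim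
  have hsrc : ∀ᶠ n in l, Φ n x₀ ∈ (𝓛.chart i).source :=
    hlim.eventually ((𝓛.chart i).open_source.mem_nhds hp)
  -- uniform positivity of the metric of the leaves
  obtain ⟨c, hc, hcB⟩ := exists_pos_eventually_le (g.pos i (z₀, t₀) (Lamination.mem_target hz₀m t₀))
  have hsm := g.smooth i
  rw [𝓛.target_eq] at hsm
  have hev := (hsm.tendsto (isOpen_openCube d) hz₀m t₀).eventually hcB
  obtain ⟨PT, hPT, PZ, hPZ, hcoeff⟩ := eventually_prod_iff.1 hev
  obtain ⟨R, hR, hRZ⟩ := Metric.eventually_nhds_iff_ball.1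
    (hPZ.and ((isOpen_openCube d).mem_nhds hz₀m))
  -- a neighbourhood of the source with uniform bounds
  obtain ⟨A₀, hA₀, hbA⟩ := hb
  have hy₀ : e x₀ ∈ e.target := e.map_source hx₀
  have hGc : ContinuousAt (metricInChart gM e) (e x₀) :=
    ((contDiffOn_metricInChart gM he).contDiffAt (e.open_target.mem_nhds hy₀)).continuousAt
  set C := ‖metricInChart gM e (e x₀)‖ + 1 with hC
  have hGC : ∀ᶠ y in 𝓝 (e x₀), ‖metricInChart gM e y‖ ≤ C :=
    (hGc.norm.eventually_lt continuousAt_const (lt_add_one _)).mono fun y hy => hy.le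
  have hbA' : ∀ᶠ y in 𝓝 (e x₀), ∀ n, CovDerivLE gM g (Φ n) 0 (e.symm y) A₀ := by
    have := (e.continuousAt_symm hy₀).tendsto
    rw [e.left_inv hx₀] at this
    exact this.eventually hbA
  obtain ⟨s₀, hs₀, hs₀B⟩ := Metric.eventually_nhds_iff_ball.1
    (hGC.and (hbA'.and (e.open_target.mem_nhds hy₀)))
  -- Bounds the ordinary derivative: the first covariant derivative involves no Christoffel symbol.
  set A := (√c)⁻¹ * (A₀ * √C) with hA
  have hA0 : 0 ≤ A := by positivity
  -- The radius `s` is independent of `n`. For late `n` the image starts within `R / 2` of `z₀` and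
  -- moves by less than `R / 2`, so it stays where the metric is controlled.
  obtain ⟨s, hs, hss₀, hAs⟩ : ∃ s, 0 < s ∧ s ≤ s₀ ∧ A * s < R / 2 := by
    refine ⟨min s₀ (R / 4 / (A + 1)), by positivity, min_le_left _ _, ?_⟩
    have h1 : min s₀ (R / 4 / (A + 1)) ≤ R / 4 / (A + 1) := min_le_right _ _
    rw [le_div_iff₀ (by positivity)] at h1
    have h2 : 0 < min s₀ (R / 4 / (A + 1)) := by positivity
    nlinarith
  have hsB : ∀ y ∈ Metric.ball (e x₀) s, ‖metricInChart gM e y‖ ≤ C ∧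
      (∀ n, CovDerivLE gM g (Φ n) 0 (e.symm y) A₀) ∧ y ∈ e.target :=
    fun y hy => hs₀B y (Metric.ball_subset_ball hss₀ hy)
  have key : ∀ᶠ n in l, ∀ y ∈ Metric.ball (e x₀) s,
      Φ n (e.symm y) ∈ (𝓛.chart i).source ∧
      𝓛.trans i (Φ n (e.symm y)) = 𝓛.trans i (Φ n x₀) ∧
      ‖𝓛.tang i (Φ n (e.symm y)) - 𝓛.tang i (Φ n x₀)‖ ≤ A * ‖y - e x₀‖ := by
    filter_upwards [hsrc, ht.eventually hPT, hz.eventually (Metric.ball_mem_nhds z₀ (half_pos hR))]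
      with n h1 h2 h3 y hy
    have hF₀ : Φ n (e.symm (e x₀)) = Φ n x₀ := by rw [e.left_inv hx₀]
    have hsub : Metric.closedBall (𝓛.tang i (Φ n x₀)) (R / 2) ⊆ Metric.ball z₀ R := fun w hw => by
      have := dist_triangle w (𝓛.tang i (Φ n x₀)) z₀
      rw [Metric.mem_closedBall] at hw
      exact Metric.mem_ball.2 (by linarith)
    have := mem_plaque_of_norm_fderiv_le (𝓛 := 𝓛) (i := i) (F := fun y => Φ n (e.symm y))
      (y₀ := e x₀) (s := s) (r := R / 2) (A := A)
      ((hΦ n).continuous.comp_continuousOn (e.continuousOn_symm.mono fun y hy => (hsB y hy).2.2))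
      (by rwa [hF₀]) hA0 hAs (by rw [hF₀]; exact fun w hw => (hRZ w (hsub hw)).2)
      (fun y hy hyi => ⟨(e.continuousAt_symm (hsB y hy).2.2).eventually ((hΦ n).2 _ i hyi).1,
        ((hΦ n).contDiffAt_tang he (hsB y hy).2.2 hyi).differentiableAt (by simp)⟩)
      (fun y hy hyi hyt hyz => ?_) hy
    · simpa only [hF₀] using this
    · rw [hF₀] at hyt hyz
      refine ContinuousLinearMap.opNorm_le_bound _ hA0 fun u => ?_
      have hyT := (hsB y hy).2.2
      have h4 := ((hsB y hy).2.1 n).norm_covDeriv_le hA₀.le he (e.map_target hyT) hyi hc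
        (fun u => by
          rw [hyt]
          exact hcoeff h2 (hRZ _ (hsub hyz)).1 u)
        (C := C) (by rw [e.right_inv hyT]; exact (hsB y hy).1) (fun _ => u)
      rw [e.right_inv hyT] at h4
      simp only [covDeriv, Finset.prod_const, Finset.card_univ, Fintype.card_fin, zero_add,
        pow_one] at h4
      exact h4.trans_eq (by ring)
  have hball : ∀ᶠ x in 𝓝 x₀, x ∈ e.source ∧ e x ∈ Metric.ball (e x₀) s :=
    Filter.Eventually.and (e.open_source.mem_nhds hx₀)
      ((e.continuousAt hx₀).eventually (Metric.ball_mem_nhds _ hs))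
  have key' : ∀ᶠ q in l ×ˢ 𝓝 x₀, Φ q.1 q.2 ∈ (𝓛.chart i).source ∧
      𝓛.trans i (Φ q.1 q.2) = 𝓛.trans i (Φ q.1 x₀) ∧
      ‖𝓛.tang i (Φ q.1 q.2) - 𝓛.tang i (Φ q.1 x₀)‖ ≤ A * ‖e q.2 - e x₀‖ := by
    filter_upwards [key.prod_mk hball] with q hq
    simpa only [e.left_inv hq.2.1] using hq.1 _ hq.2.2
  refine ⟨key'.mono fun q hq => ⟨hq.1, hq.2.1⟩, ?_⟩
  have hT : Tendsto (fun q : ι' × M => 𝓛.trans i (Φ q.1 q.2)) (l ×ˢ 𝓝 x₀) (𝓝 t₀) :=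
    (ht.comp tendsto_fst).congr' (key'.mono fun q hq => hq.2.1.symm)
  have hZ : Tendsto (fun q : ι' × M => 𝓛.tang i (Φ q.1 q.2)) (l ×ˢ 𝓝 x₀) (𝓝 z₀) := by
    have h1 : Tendsto (fun q : ι' × M => A * ‖e q.2 - e x₀‖) (l ×ˢ 𝓝 x₀) (𝓝 0) := by
      have : Tendsto (fun x => A * ‖e x - e x₀‖) (𝓝 x₀) (𝓝 (A * ‖e x₀ - e x₀‖)) :=
        (((e.continuousAt hx₀).sub continuousAt_const).norm.const_mul A)
      rw [sub_self, norm_zero, mul_zero] at this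
      exact this.comp tendsto_snd
    have h2 := squeeze_zero_norm' (key'.mono fun q hq => hq.2.2) h1
    simpa using h2.add (hz.comp tendsto_fst)
  have hfin := ((𝓛.chart i).continuousAt_symm (Lamination.mem_target hz₀m t₀)).tendsto.comp
    (hZ.prodMk_nhds hT)
  rw [Lamination.symm_tang_trans hp] at hfin
  refine hfin.congr' (key'.mono fun q hq => ?_)
  exact Lamination.symm_tang_trans hq.1

end LeafMaps

/-! ### Derivative bounds, equicontinuity and compactness -/

section Compactness

set_option maxSynthPendingDepth 3

variable {m d : ℕ} {X : Type*} [TopologicalSpace X] {𝓛 : Lamination d X}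
  {M : Type*} [TopologicalSpace M] [ChartedSpace (EuclideanSpace ℝ (Fin m)) M]
  [IsManifold (𝓡 m) ∞ M] {e : OpenPartialHomeomorph M (EuclideanSpace ℝ (Fin m))}
  (gM : Bundle.ContMDiffRiemannianMetric (𝓡 m) ∞ (EuclideanSpace ℝ (Fin m))
      (fun x : M => TangentSpace (𝓡 m) x)) (g : LaminatedMetric 𝓛)

include gM g in
/-- Maps into leaves with bounded covariant derivatives which converge at a point have bounded
derivatives in the charts around this point. -/
theorem locBdd_tang [T2Space X] {ι' : Type*} {l : Filter ι'} {Φ : ι' → M → X} {x₀ : M} {i : 𝓛.ι}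
    {p : X} (hΦ : ∀ n, SmoothIntoLeaf (m := m) 𝓛 (Φ n))
    (hb : ∀ k, ∃ A : ℝ, 0 < A ∧ ∀ᶠ x in 𝓝 x₀, ∀ n, CovDerivLE gM g (Φ n) k x A)
    (hp : p ∈ (𝓛.chart i).source) (hlim : Tendsto (fun n => Φ n x₀) l (𝓝 p))
    (he : e ∈ atlas (EuclideanSpace ℝ (Fin m)) M) (hx₀ : x₀ ∈ e.source) (j : ℕ) :
    LocBdd l (fun n y => 𝓛.tang i (Φ n (e.symm y))) (e x₀) j := by
  obtain ⟨hpl, hconv⟩ := eventually_mem_plaque_and_tendsto gM g hΦ (hb 0) hp hlim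
  have hy₀ : e x₀ ∈ e.target := e.map_source hx₀
  have hz₀m : 𝓛.tang i p ∈ openCube d := Lamination.tang_mem_openCube hp
  have ht : Tendsto (fun n => 𝓛.trans i (Φ n x₀)) l (𝓝 (𝓛.trans i p)) :=
    (Lamination.continuousAt_trans hp).tendsto.comp hlim
  have hsymm : Tendsto (fun q : ι' × EuclideanSpace ℝ (Fin m) => (q.1, e.symm q.2))
      (l ×ˢ 𝓝 (e x₀)) (l ×ˢ 𝓝 x₀) := by
    have := (e.continuousAt_symm hy₀).tendsto
    rw [e.left_inv hx₀] at this
    exact tendsto_fst.prodMk (this.comp tendsto_snd)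
  have htgt : ∀ᶠ q in l ×ˢ 𝓝 (e x₀), q.2 ∈ e.target :=
    Eventually.prod_inr (e.open_target.mem_nhds hy₀) l
  have hft : Tendsto (fun q : ι' × EuclideanSpace ℝ (Fin m) => 𝓛.tang i (Φ q.1 (e.symm q.2)))
      (l ×ˢ 𝓝 (e x₀)) (𝓝 (𝓛.tang i p)) :=
    (Lamination.continuousAt_tang hp).tendsto.comp (hconv.comp hsymm)
  have hpos := g.pos i (𝓛.tang i p, 𝓛.trans i p) (Lamination.mem_target hz₀m _)
  have hsm := g.smooth i
  rw [𝓛.target_eq] at hsm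
  have hcont := hsm.tendsto (isOpen_openCube d) hz₀m (𝓛.trans i p)
  have hG := contDiffOn_metricInChart gM he
  -- The transverse coordinate is frozen at that of `Φ n x₀`, giving one metric for each `n`. This
  -- is legitimate because nearby points are sent to the same plaque.
  refine locBdd_of_covDeriv_bounded (G := metricInChart gM e)
    (G' := fun n z => g.coeff i (z, 𝓛.trans i (Φ n x₀))) (z₀ := 𝓛.tang i p)
    (B₀ := g.coeff i (𝓛.tang i p, 𝓛.trans i p)) ?_ ?_ ?_ ?_ ?_ ?_ hft ?_ j
  · filter_upwards [e.open_target.mem_nhds hy₀] with y hy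
      using hG.contDiffAt (e.open_target.mem_nhds hy)
  · exact isInvertible_of_pos (metricInChart_pos gM he hy₀)
  · exact fun j => hsm.locBdd (isOpen_openCube d) hz₀m ht j
  · exact hcont.comp ((ht.comp tendsto_fst).prodMk tendsto_snd)
  · exact isInvertible_of_pos hpos
  · filter_upwards [htgt, hsymm.eventually hpl] with q h1 h2
      using (hΦ q.1).contDiffAt_tang he h1 h2.1
  · intro k v
    obtain ⟨A, hA, hbA⟩ := hb k
    obtain ⟨c, hc, hcB⟩ := exists_pos_eventually_le hpos
    have hcoeff := (hcont.comp ((ht.comp tendsto_fst).prodMk hft)).eventually hcB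
    have hGc : ContinuousAt (metricInChart gM e) (e x₀) :=
      (hG.contDiffAt (e.open_target.mem_nhds hy₀)).continuousAt
    have hGC := (hGc.norm.eventually_lt continuousAt_const (lt_add_one _)).prod_inr l
    refine ⟨(√c)⁻¹ * (A * ∏ a, (√(‖metricInChart gM e (e x₀)‖ + 1) * ‖v a‖)), ?_⟩
    filter_upwards [htgt, hsymm.eventually hpl, hsymm.eventually (hbA.prod_inr l), hcoeff, hGC]
      with q h1 h2 h3 h4 h5
    have := (h3 q.1).norm_covDeriv_le hA.le he (e.map_target h1) h2.1 hc
      (fun u => by rw [h2.2]; exact h4 u) (C := ‖metricInChart gM e (e x₀)‖ + 1)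
      (by rw [e.right_inv h1]; exact h5.le) v
    rw [e.right_inv h1, h2.2] at this
    exact this

include gM in
/-- Maps into leaves with bounded covariant derivatives are equicontinuous. -/
theorem equicontinuous_of_covDerivLE {X : Type*} [UniformSpace X] [T2Space X] [CompactSpace X]
    {𝓛 : Lamination d X} (g : LaminatedMetric 𝓛) {ι' : Type*} {Φ : ι' → M → X}
    (hΦ : ∀ n, SmoothIntoLeaf (m := m) 𝓛 (Φ n))
    (hb : ∀ x₀, ∃ A : ℝ, 0 < A ∧ ∀ᶠ x in 𝓝 x₀, ∀ n, CovDerivLE gM g (Φ n) 0 x A) :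
    Equicontinuous Φ := by
  intro x₀ U hU
  by_contra hcon
  have hfreq : ∃ᶠ x in 𝓝 x₀, ∃ n, (Φ n x₀, Φ n x) ∉ U := by
    simpa only [not_eventually, not_forall] using hcon
  -- The bad index depends on `x`, so pairs `(n, x)` are followed along an ultrafilter. By
  -- compactness `Φ n x₀` converges along it, and the joint convergence in `n` and `x` forces `Φ n
  -- x` to the same limit.
  have hne : (comap (Prod.snd : ι' × M → M) (𝓝 x₀) ⊓
      𝓟 {q | (Φ q.1 x₀, Φ q.1 q.2) ∉ U}).NeBot := by
    rw [← frequently_mem_iff_neBot, frequently_comap]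
    exact hfreq.mono fun x ⟨n, hn⟩ => ⟨(n, x), rfl, hn⟩
  obtain ⟨𝒰, h𝒰⟩ := Ultrafilter.exists_le
    (comap (Prod.snd : ι' × M → M) (𝓝 x₀) ⊓ 𝓟 {q | (Φ q.1 x₀, Φ q.1 q.2) ∉ U})
  have hsnd : Tendsto Prod.snd (𝒰 : Filter (ι' × M)) (𝓝 x₀) :=
    tendsto_comap.mono_left (h𝒰.trans inf_le_left)
  have hbad : ∀ᶠ q in (𝒰 : Filter (ι' × M)), (Φ q.1 x₀, Φ q.1 q.2) ∉ U :=
    (h𝒰.trans inf_le_right) (mem_principal_self _)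
  obtain ⟨p, hp⟩ : ∃ p, Tendsto (fun q : ι' × M => Φ q.1 x₀) 𝒰 (𝓝 p) := by
    obtain ⟨p, -, hp⟩ := isCompact_univ.ultrafilter_le_nhds (𝒰.map fun q : ι' × M => Φ q.1 x₀)
      (by simp)
    exact ⟨p, hp⟩
  obtain ⟨i, hi⟩ := 𝓛.cover p
  have hconv := (eventually_mem_plaque_and_tendsto gM g hΦ (hb x₀) hi
    (l := map Prod.fst (𝒰 : Filter (ι' × M))) hp).2
  have hid : Tendsto (fun q : ι' × M => (q.1, q.2)) 𝒰 (map Prod.fst (𝒰 : Filter (ι' × M)) ×ˢ 𝓝 x₀) :=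
    tendsto_map.prodMk hsnd
  have hlim : ∀ᶠ q in (𝒰 : Filter (ι' × M)), (Φ q.1 x₀, Φ q.1 q.2) ∈ U :=
    (hp.prodMk_nhds (hconv.comp hid)) (nhds_le_uniformity p hU)
  obtain ⟨q, h1, h2⟩ := (hlim.and hbad).exists
  exact h2 h1

/-- **Arzelà–Ascoli**: an equicontinuous sequence of maps to a compact metrizable space has a
subsequence which converges in the compact-open topology. -/
theorem exists_subseq_tendsto_of_equicontinuous {M X : Type*} [TopologicalSpace M]
    [WeaklyLocallyCompactSpace M] [SigmaCompactSpace M] [UniformSpace X] [T2Space X]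
    [CompactSpace X] [TopologicalSpace.MetrizableSpace X] (F : ℕ → C(M, X))
    (hF : Equicontinuous fun n => (F n : M → X)) :
    ∃ (Ψ : C(M, X)) (σ : ℕ → ℕ), StrictMono σ ∧ Tendsto (fun n => F (σ n)) atTop (𝓝 Ψ) := by
  have hcpt : IsCompact (closure (range F)) := by
    refine ArzelaAscoli.isCompact_closure_of_isClosedEmbedding (F := fun f : C(M, X) => (f : M → X))
      (𝔖 := {K | IsCompact K}) (fun K hK => hK) ?_ (fun K hK => ?_)
      (fun K hK x hx => ⟨univ, isCompact_univ, fun _ _ => mem_univ _⟩)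
    · have : T2Space (UniformOnFun M X {K | IsCompact K}) := UniformOnFun.t2Space_of_covering
        (eq_univ_iff_forall.2 fun x => ⟨{x}, isCompact_singleton, mem_singleton x⟩)
      exact ContinuousMap.isUniformEmbedding_toUniformOnFunIsCompact.isClosedEmbedding
    · intro x hx U hU
      filter_upwards [nhdsWithin_le_nhds (hF x U hU)] with y hy
      rintro ⟨_, n, rfl⟩
      exact hy n
  -- Extracting a subsequence uses that `C(M, X)` is first countable, as `M` is locally compact and
  -- σ-compact and `X` metrizable.
  obtain ⟨Ψ, -, σ, hσ, h⟩ := hcpt.tendsto_subseq fun n => subset_closure (mem_range_self n)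
  exact ⟨Ψ, σ, hσ, h⟩

theorem tendstoUniformlyOnFilter_of_tendsto_prod {ι α β : Type*} [TopologicalSpace α]
    [UniformSpace β] {l : Filter ι} {F : ι → α → β} {f : α → β} {x : α}
    (hF : Tendsto (fun q : ι × α => F q.1 q.2) (l ×ˢ 𝓝 x) (𝓝 (f x))) (hf : ContinuousAt f x) :
    TendstoUniformlyOnFilter F f l (𝓝 x) := by
  rw [tendstoUniformlyOnFilter_iff_tendsto]
  exact ((hf.tendsto.comp tendsto_snd).prodMk_nhds hF).mono_right (nhds_le_uniformity (f x))

omit [IsManifold (𝓡 m) ∞ M] in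
/-- On a connected space, a map which is locally in a plaque has its image in a leaf. -/
theorem mem_leaf_of_eventually_mem_plaque [PreconnectedSpace M] {Ψ : M → X}
    (h : ∀ x, ∃ i, ∀ᶠ y in 𝓝 x, Ψ y ∈ (𝓛.chart i).source ∧ 𝓛.trans i (Ψ y) = 𝓛.trans i (Ψ x))
    (x₁ x : M) : Ψ x ∈ 𝓛.leaf (Ψ x₁) := by
  have hplaque : ∀ x, ∀ᶠ y in 𝓝 x, Relation.EqvGen 𝓛.SamePlaque (Ψ x) (Ψ y) := fun x => by
    obtain ⟨i, hi⟩ := h x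
    filter_upwards [hi] with y hy using .rel _ _ ⟨i, hi.self_of_nhds.1, hy.1, hy.2.symm⟩
  -- As the leaf relation is symmetric, lying outside the leaf is a local property just like lying
  -- in it.
  have hclopen : IsClopen {x | Ψ x ∈ 𝓛.leaf (Ψ x₁)} := by
    refine ⟨⟨isOpen_iff_eventually.2 fun x hx => ?_⟩, isOpen_iff_eventually.2 fun x hx => ?_⟩
    · filter_upwards [hplaque x] with y hy hy' using hx (.trans _ _ _ hy' (.symm _ _ hy))
    · filter_upwards [hplaque x] with y hy using .trans _ _ _ hx hy
  have := hclopen.eq_univ ⟨x₁, Relation.EqvGen.refl _⟩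
  exact eq_univ_iff_forall.1 this x

end Compactness

/-! ### Extraction of the subsequence and regularity of its limit -/

theorem mainTheorem10 {m d : ℕ}
    {X : Type*} [TopologicalSpace X] [CompactSpace X] [TopologicalSpace.MetrizableSpace X]
    (𝓛 : Lamination d X) (g : LaminatedMetric 𝓛)
    {M : Type*} [TopologicalSpace M] [T2Space M] [SecondCountableTopology M] [ConnectedSpace M]
    [ChartedSpace (EuclideanSpace ℝ (Fin m)) M] [IsManifold (𝓡 m) ∞ M]
    (gM : Bundle.ContMDiffRiemannianMetric (𝓡 m) ∞ (EuclideanSpace ℝ (Fin m))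
      (fun x : M => TangentSpace (𝓡 m) x))
    (Φ : ℕ → M → X) (hΦ : ∀ n, SmoothIntoLeaf (m := m) 𝓛 (Φ n))
    (hbound : ∀ K : Set M, IsCompact K → ∀ k : ℕ, ∃ A : ℝ, 0 < A ∧
      ∀ n, ∀ x ∈ K, CovDerivLE gM g (Φ n) k x A) :
    ∃ (Ψ : M → X) (σ : ℕ → ℕ), SmoothIntoLeaf (m := m) 𝓛 Ψ ∧ StrictMono σ ∧
      TendstoCInfLoc (m := m) 𝓛 (fun n => Φ (σ n)) Ψ := by
  have : LocallyCompactSpace M := ChartedSpace.locallyCompactSpace (EuclideanSpace ℝ (Fin m)) M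
  let : MetricSpace X := TopologicalSpace.metrizableSpaceMetric X
  have hb : ∀ x₀ k, ∃ A : ℝ, 0 < A ∧ ∀ᶠ x in 𝓝 x₀, ∀ n, CovDerivLE gM g (Φ n) k x A :=
    fun x₀ k => by
      obtain ⟨K, hK, hKx⟩ := exists_compact_mem_nhds x₀
      obtain ⟨A, hA, h⟩ := hbound K hK k
      exact ⟨A, hA, by filter_upwards [hKx] with x hx n using h n x hx⟩
  obtain ⟨Ψ, σ, hσ, hlim⟩ := exists_subseq_tendsto_of_equicontinuous
    (fun n => (⟨Φ n, (hΦ n).continuous⟩ : C(M, X)))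
    (equicontinuous_of_covDerivLE gM g hΦ fun x₀ => hb x₀ 0)
  have hΦ' : ∀ n, SmoothIntoLeaf (m := m) 𝓛 (Φ (σ n)) := fun n => hΦ (σ n)
  have hb' : ∀ x₀ k, ∃ A : ℝ, 0 < A ∧ ∀ᶠ x in 𝓝 x₀, ∀ n, CovDerivLE gM g (Φ (σ n)) k x A :=
    fun x₀ k => (hb x₀ k).imp fun A hA => ⟨hA.1, hA.2.mono fun x hx n => hx (σ n)⟩
  have hpt : ∀ x, Tendsto (fun n => Φ (σ n) x) atTop (𝓝 (Ψ x)) := fun x =>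
    ((continuous_eval_const x).tendsto Ψ).comp hlim
  have hloc : ∀ x i, Ψ x ∈ (𝓛.chart i).source →
      (∀ᶠ q in atTop ×ˢ 𝓝 x, Φ (σ q.1) q.2 ∈ (𝓛.chart i).source ∧
        𝓛.trans i (Φ (σ q.1) q.2) = 𝓛.trans i (Φ (σ q.1) x)) ∧
      Tendsto (fun q : ℕ × M => Φ (σ q.1) q.2) (atTop ×ˢ 𝓝 x) (𝓝 (Ψ x)) := fun x i hi =>
    eventually_mem_plaque_and_tendsto gM g hΦ' (hb' x 0) hi (hpt x)
  have hplaque : ∀ x i, Ψ x ∈ (𝓛.chart i).source → ∀ᶠ y in 𝓝 x,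
      Ψ y ∈ (𝓛.chart i).source ∧ 𝓛.trans i (Ψ y) = 𝓛.trans i (Ψ x) := fun x i hi => by
    obtain ⟨S, hS, Q, hQ, H⟩ := eventually_prod_iff.1 (hloc x i hi).1
    filter_upwards [hQ, Ψ.continuous.continuousAt.eventually
      ((𝓛.chart i).open_source.mem_nhds hi)] with y hy hyi
    -- For late `n` the points `x` and `y` are sent to one plaque, so the transverse coordinates
    -- have the same limit at both.
    refine ⟨hyi, tendsto_nhds_unique
      ((Lamination.continuousAt_trans hyi).tendsto.comp (hpt y)) ?_⟩
    refine ((Lamination.continuousAt_trans hi).tendsto.comp (hpt x)).congr' ?_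
    filter_upwards [hS] with n hn using (H hn hy).2.symm
  -- convergence and regularity in the charts
  have hchart : ∀ e ∈ atlas (EuclideanSpace ℝ (Fin m)) M, ∀ i : 𝓛.ι,
      IsOpen (e.target ∩ e.symm ⁻¹' (Ψ ⁻¹' (𝓛.chart i).source)) ∧ ∀ k : ℕ,
      ContDiffOn ℝ k (fun y => 𝓛.tang i (Ψ (e.symm y)))
        (e.target ∩ e.symm ⁻¹' (Ψ ⁻¹' (𝓛.chart i).source)) ∧
      ∀ y ∈ e.target ∩ e.symm ⁻¹' (Ψ ⁻¹' (𝓛.chart i).source), TendstoUniformlyOnFilter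
        (fun n => iteratedFDeriv ℝ k (fun y' => 𝓛.tang i (Φ (σ n) (e.symm y'))))
        (iteratedFDeriv ℝ k (fun y' => 𝓛.tang i (Ψ (e.symm y')))) atTop (𝓝 y) := by
    intro e he i
    have hO : IsOpen (e.target ∩ e.symm ⁻¹' (Ψ ⁻¹' (𝓛.chart i).source)) :=
      e.symm.isOpen_inter_preimage ((𝓛.chart i).open_source.preimage Ψ.continuous)
    refine ⟨hO, fun k => contDiffOn_and_tendstoUniformlyOnFilter_iteratedFDeriv hO
      (fun y hy j => ?_) (fun y hy => ?_) k⟩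
    · have := locBdd_tang gM g hΦ' (hb' (e.symm y)) hy.2 (hpt _) he (e.map_target hy.1) j
      rwa [e.right_inv hy.1] at this
    · refine tendstoUniformlyOnFilter_of_tendsto_prod ?_ ?_
      · exact (Lamination.continuousAt_tang hy.2).tendsto.comp ((hloc _ i hy.2).2.comp
          (tendsto_fst.prodMk ((e.continuousAt_symm hy.1).tendsto.comp tendsto_snd)))
      · exact (Lamination.continuousAt_tang hy.2).comp (f := fun y => Ψ (e.symm y))
          (Ψ.continuous.continuousAt.comp (e.continuousAt_symm hy.1))
  refine ⟨Ψ, σ, ⟨?_, fun x i hi => ⟨hplaque x i hi, ?_⟩⟩, hσ,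
    ContinuousMap.tendsto_nhds_compactOpen.1 hlim |> fun h K U hK hU hm => h K hK U hU hm,
    fun e he i K hK hKe hKi k => ?_⟩
  · obtain ⟨x₁⟩ := (inferInstance : Nonempty M)
    exact ⟨Ψ x₁, mem_leaf_of_eventually_mem_plaque
      (fun x => (𝓛.cover (Ψ x)).imp fun i hi => hplaque x i hi) x₁⟩
  · set e := chartAt (EuclideanSpace ℝ (Fin m)) x with he'
    have hx : x ∈ e.source := mem_chart_source _ _
    obtain ⟨hO, H⟩ := hchart e (chart_mem_atlas _ _) i
    have hmem : e x ∈ e.target ∩ e.symm ⁻¹' (Ψ ⁻¹' (𝓛.chart i).source) :=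
      ⟨e.map_source hx, by simpa [e.left_inv hx] using hi⟩
    have hsm : ContDiffAt ℝ ∞ (fun y => 𝓛.tang i (Ψ (e.symm y))) (e x) :=
      (contDiffOn_infty.2 fun k => (H k).1).contDiffAt (hO.mem_nhds hmem)
    have hcomp := hsm.contMDiffAt.comp x (contMDiffAt_of_mem_maximalAtlas (I := 𝓡 m) (n := ∞)
      (IsManifold.subset_maximalAtlas (chart_mem_atlas _ x)) hx)
    refine hcomp.congr_of_eventuallyEq ?_
    filter_upwards [e.open_source.mem_nhds hx] with y hy
    simp only [Function.comp_apply]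
    erw [e.left_inv hy]
  · obtain ⟨hO, H⟩ := hchart e he i
    have hsub : e '' K ⊆ e.target ∩ e.symm ⁻¹' (Ψ ⁻¹' (𝓛.chart i).source) := by
      rintro _ ⟨x, hx, rfl⟩
      exact ⟨e.map_source (hKe hx), by simpa [e.left_inv (hKe hx)] using hKi hx⟩
    refine (tendstoLocallyUniformlyOn_iff_forall_isCompact hO).1 ?_ _ hsub
      (hK.image_of_continuousOn (e.continuousOn.mono hKe))
    refine tendstoLocallyUniformlyOn_iff_filter.2 fun y hy => ?_
    rw [hO.nhdsWithin_eq hy]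
    exact (H k).2 y hy
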